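/- Consider a monitor that receives updates from two sensors A and B. Both sensors submit their first update at time $0$; each sensor generates and submits a new update at the moment its previous update is received by the monitor, so that an update is received one service time after its generation. The service times of sensor A are independent and exponentially distributed with rate $\mu>0$; every service time of sensor B equals the constant $T>0$ (the M-D system). At time $0$ the monitor holds information of some age $a_0\ge 0$. The age of information (AoI) $\Delta(t)$ is the time elapsed since the generation of the freshest information that the monitor has received up to time $t$ from either sensor. Then, almost surely, the time-average AoI exists and equals $$\lim_{\tau\to\infty}\frac1\tau\int_0^\tau\Delta(t)\,dt=\Delta_{\mathrm{M\text{-}D}}:=\frac{3+2T\mu+e^{T\mu}\bigl(-3+(-1+2e^{T\mu})T\mu\bigr)}{T\mu^2e^{2T\mu}}.$$ Moreover, for every service period $((j+1)T,(j+2)T]$ of sensor B, $j\ge 0$, let $Q=\int_{(j+1)T}^{(j+2)T}\Delta(t)\,dt$, and say that the system is in state $(k,n)$ if sensor A delivers $k$ updates during the previous period $(jT,(j+1)T]$ and $n$ updates during the current period $((j+1)T,(j+2)T]$. Then $Q$ is integrable, state $(k,n)$ has probability $\frac{(\mu T)^k}{k!}e^{-\mu T}\cdot\frac{(\mu T)^n}{n!}e^{-\mu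 T}$ for all $k,n\ge 0$, and $$\sum_{k,n\ge 0}\frac{(\mu T)^k}{k!}e^{-\mu T}\,\frac{(\mu T)^n}{n!}e^{-\mu T}\cdot\frac{\mathbb{E}[Q\mid(k,n)]}{T}=\Delta_{\mathrm{M\text{-}D}}.$$ -/

import Mathlib

open MeasureTheory ProbabilityTheory Filter Topology

/-- Generation time of update number `i` (counted from `0`) of a sensor whose successive service
times are `s 0, s 1, …`. The sensor submits its first update at time `0` and a new update at the
moment at which the previous one is received. -/
def genTime (s : ℕ → ℝ) (i : ℕ) : ℝ := ∑ m ∈ Finset.range i, s m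

/-- Time at which the monitor receives update number `i`: generation time plus service time. -/
def recvTime (s : ℕ → ℝ) (i : ℕ) : ℝ := genTime s i + s i

/-- Generation times of the information available at the monitor at time `t` in a system of two
parallel sensors with service times `sA` and `sB`: all updates received up to time `t`, and the
information of age `a₀` which the monitor holds at time `0`. -/
def receivedGenTimes (a₀ : ℝ) (sA sB : ℕ → ℝ) (t : ℝ) : Set ℝ :=
  {-a₀} ∪ {g | ∃ i, recvTime sA i ≤ t ∧ g = genTime sA i}
    ∪ {g | ∃ i, recvTime sB i ≤ t ∧ g = genTime sB i}

/-- Instantaneous age of information at the monitor: the time elapsed since the generation of the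
freshest update received so far (obsolete updates do not change it). -/
noncomputable def aoi (a₀ : ℝ) (sA sB : ℕ → ℝ) (t : ℝ) : ℝ :=
  t - sSup (receivedGenTimes a₀ sA sB t)

/-- Instantaneous age of information in the M-D system, in which sensor A has the service times
`sA` and every service time of sensor B equals `T`. -/
noncomputable def aoiMD (a₀ T : ℝ) (sA : ℕ → ℝ) (t : ℝ) : ℝ :=
  aoi a₀ sA (fun _ => T) t

/-- Number of updates of the sensor with service times `s` that are received during `(a, b]`. -/
noncomputable def numReceived (s : ℕ → ℝ) (a b : ℝ) : ℕ∞ :=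
  {i : ℕ | a < recvTime s i ∧ recvTime s i ≤ b}.encard

/-- The area under the age curve of the M-D system in the service period `(j T, (j + 1) T]` of
sensor B. -/
noncomputable def periodArea (a₀ T : ℝ) (sA : ℕ → ℝ) (j : ℕ) : ℝ :=
  ∫ t in (j * T)..((j + 1) * T), aoiMD a₀ T sA t

/-- The event that the M-D system is in state `(k, n)` in period `j + 1` of sensor B: sensor A
delivers `k` updates in the previous period `(j T, (j + 1) T]` and `n` updates in the current
period `((j + 1) T, (j + 2) T]`. -/
def stateEvent {Ω : Type*} (T : ℝ) (S : ℕ → Ω → ℝ) (j k n : ℕ) : Set Ω :=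
  {ω | numReceived (fun i => S i ω) (j * T) ((j + 1) * T) = k ∧
    numReceived (fun i => S i ω) ((j + 1) * T) ((j + 2) * T) = n}

/-- The probability that a Poisson variable with mean `r` equals `k`. -/
noncomputable def poissonProb (r : ℝ) (k : ℕ) : ℝ := r ^ k / (k.factorial : ℝ) * Real.exp (-r)

/-! ### Arrival sequences -/

/-! Every update of A after the first is generated when its predecessor is received. Inside a period
of B starting at `(j+1)T`, B guarantees information generated at `jT` and nothing newer. Hence for
`r > jT` the freshest information at `t` was generated by time `r` iff A delivers at most one update
in `(r, t]` (`freshest_le_iff_mem_fewReceived`). The age at `t` is therefore the length of the set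
of such `r` in `(jT, t]`, and the area under the age curve is the planar measure of `ageRegion`
(`periodArea_succ`).

Receptions from A form a Poisson process: conditioning on the first service time and lack of memory
give the Markov property at a fixed time (`expSeq_inter_of_isShiftOf`) and Poisson counts
(`expSeq_stage`). By Tonelli the mean area is the double integral of `(1 + μ(t-r)) e^{-μ(t-r)}`,
which is `T` times the stated value (`integral_ageArea_zero`).

The area of a period depends only on receptions in that period and the one before. So areas are
identically distributed, and independent when their periods are at least two apart. The strong law,
applied separately to even and odd periods, gives the time average (`ae_tendsto_average_aoiMD`). The
sum over states is the law of total expectation for the partition by the two independent Poisson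
counts (`hasSum_cond_average`). -/

lemma genTime_zero (s : ℕ → ℝ) : genTime s 0 = 0 := by simp [genTime]

lemma genTime_succ (s : ℕ → ℝ) (i : ℕ) : genTime s (i + 1) = recvTime s i := by
  simp [genTime, recvTime, Finset.sum_range_succ]

lemma recvTime_zero (s : ℕ → ℝ) : recvTime s 0 = s 0 := by simp [recvTime, genTime]

lemma recvTime_succ (s : ℕ → ℝ) (i : ℕ) : recvTime s (i + 1) = recvTime s i + s (i + 1) := by
  rw [recvTime, genTime_succ]

lemma genTime_congr {s s' : ℕ → ℝ} {n : ℕ} (h : ∀ i < n, s i = s' i) :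
    genTime s n = genTime s' n :=
  Finset.sum_congr rfl fun i hi => h i (Finset.mem_range.1 hi)

lemma recvTime_congr {s s' : ℕ → ℝ} {n i : ℕ} (h : ∀ i < n, s i = s' i) (hi : i < n) :
    recvTime s i = recvTime s' i := by
  rw [← genTime_succ, ← genTime_succ]
  exact genTime_congr fun j hj => h j (by omega)

lemma genTime_mono {s : ℕ → ℝ} (hs : ∀ i, 0 ≤ s i) : Monotone (genTime s) :=
  monotone_nat_of_le_succ fun i => by
    rw [genTime_succ, recvTime]; linarith [hs i]

lemma recvTime_mono {s : ℕ → ℝ} (hs : ∀ i, 0 ≤ s i) : Monotone (recvTime s) :=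
  monotone_nat_of_le_succ fun i => by
    rw [recvTime_succ]; linarith [hs (i + 1)]

lemma genTime_nonneg {s : ℕ → ℝ} (hs : ∀ i, 0 ≤ s i) (i : ℕ) : 0 ≤ genTime s i :=
  Finset.sum_nonneg fun m _ => hs m

lemma recvTime_pos {s : ℕ → ℝ} (hs : ∀ i, 0 < s i) (i : ℕ) : 0 < recvTime s i :=
  add_pos_of_nonneg_of_pos (genTime_nonneg (fun i => (hs i).le) i) (hs i)

@[fun_prop]
lemma measurable_genTime (i : ℕ) : Measurable fun s : ℕ → ℝ => genTime s i := by
  unfold genTime; fun_prop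

@[fun_prop]
lemma measurable_recvTime (i : ℕ) : Measurable fun s : ℕ → ℝ => recvTime s i := by
  unfold recvTime; fun_prop

/-- The service time sequences for which exactly `n` updates are received up to time `c`. -/
def stage (c : ℝ) (n : ℕ) : Set (ℕ → ℝ) := {s | genTime s n ≤ c ∧ c < recvTime s n}

lemma measurableSet_stage (c : ℝ) (n : ℕ) : MeasurableSet (stage c n) :=
  (measurableSet_le (measurable_genTime n) measurable_const).inter
    (measurableSet_lt measurable_const (measurable_recvTime n))

lemma recvTime_le_iff_of_mem_stage {s : ℕ → ℝ} (hs : ∀ i, 0 ≤ s i) {c : ℝ} {n : ℕ}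
    (h : s ∈ stage c n) (i : ℕ) : recvTime s i ≤ c ↔ i < n := by
  constructor
  · intro hi
    by_contra! hn
    exact absurd (h.2.trans_le (recvTime_mono hs hn)) (not_lt.2 hi)
  · intro hi
    rw [← genTime_succ]
    exact (genTime_mono hs hi).trans h.1

lemma stage_unique {s : ℕ → ℝ} (hs : ∀ i, 0 ≤ s i) {c : ℝ} {m n : ℕ} (hm : s ∈ stage c m)
    (hn : s ∈ stage c n) : m = n := by
  have h i := (recvTime_le_iff_of_mem_stage hs hm i).symm.trans
    (recvTime_le_iff_of_mem_stage hs hn i)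
  have h1 := h m
  have h2 := h n
  omega

/-- The service times seen by an observer who starts at time `c`, when `n` updates have been
received up to that time. -/
def residualSeq (c : ℝ) (n : ℕ) (s : ℕ → ℝ) : ℕ → ℝ
  | 0 => recvTime s n - c
  | i + 1 => s (n + (i + 1))

lemma measurable_residualSeq (c : ℝ) (n : ℕ) : Measurable (residualSeq c n) :=
  measurable_pi_iff.2 fun i => by cases i <;> simp only [residualSeq] <;> fun_prop

lemma recvTime_residualSeq (c : ℝ) (n : ℕ) (s : ℕ → ℝ) (i : ℕ) :
    recvTime (residualSeq c n s) i = recvTime s (n + i) - c := by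
  induction i with
  | zero => simp [recvTime_zero, residualSeq]
  | succ i ih => rw [recvTime_succ, ih, ← add_assoc, recvTime_succ, residualSeq, add_assoc n]; ring

/-- The sequence with first term `x` and remaining terms `s`. -/
def seqCons (x : ℝ) (s : ℕ → ℝ) : ℕ → ℝ
  | 0 => x
  | i + 1 => s i

lemma measurable_seqCons : Measurable fun p : ℝ × (ℕ → ℝ) => seqCons p.1 p.2 :=
  measurable_pi_iff.2 fun i => by cases i <;> simp only [seqCons] <;> fun_prop

lemma genTime_seqCons_succ (x : ℝ) (s : ℕ → ℝ) (n : ℕ) :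
    genTime (seqCons x s) (n + 1) = x + genTime s n := by
  simp [genTime, Finset.sum_range_succ', seqCons, add_comm]

lemma recvTime_seqCons_zero (x : ℝ) (s : ℕ → ℝ) : recvTime (seqCons x s) 0 = x := by
  simp [recvTime_zero, seqCons]

lemma recvTime_seqCons_succ (x : ℝ) (s : ℕ → ℝ) (n : ℕ) :
    recvTime (seqCons x s) (n + 1) = x + recvTime s n := by
  rw [← genTime_succ, genTime_seqCons_succ, genTime_succ]

lemma seqCons_mem_stage_succ (c x : ℝ) (s : ℕ → ℝ) (n : ℕ) :
    seqCons x s ∈ stage c (n + 1) ↔ s ∈ stage (c - x) n := by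
  simp only [stage, Set.mem_ofPred_eq, genTime_seqCons_succ, recvTime_seqCons_succ]
  constructor <;> rintro ⟨h1, h2⟩ <;> constructor <;> linarith

lemma residualSeq_seqCons_succ (c x : ℝ) (n : ℕ) (s : ℕ → ℝ) :
    residualSeq c (n + 1) (seqCons x s) = residualSeq (c - x) n s := by
  funext i
  cases i with
  | zero => simp only [residualSeq, recvTime_seqCons_succ]; ring
  | succ i => simp only [residualSeq]; rw [show n + 1 + (i + 1) = (n + (i + 1)) + 1 by ring]; rfl

lemma residualSeq_seqCons_zero (c x : ℝ) (s : ℕ → ℝ) :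
    residualSeq c 0 (seqCons x s) = seqCons (x - c) s := by
  funext i
  cases i with
  | zero => simp [residualSeq, recvTime_seqCons_zero, seqCons]
  | succ i => simp [residualSeq, seqCons]

/-! ### Independent exponential service times -/

/-- The law of a sequence of independent exponential variables of rate `μ`. -/
noncomputable def expSeq (μ : ℝ) : Measure (ℕ → ℝ) := Measure.infinitePi fun _ => expMeasure μ

lemma isProbabilityMeasure_expSeq {μ : ℝ} (hμ : 0 < μ) : IsProbabilityMeasure (expSeq μ) := by
  have := isProbabilityMeasure_expMeasure hμ
  unfold expSeq
  infer_instance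

/-- The infinite product is determined by its values on boxes with finitely many constrained
coordinates; splitting off coordinate `0` shifts the others by one. This is what permits
conditioning on the first service time. -/
lemma map_seqCons_expSeq {μ : ℝ} (hμ : 0 < μ) :
    ((expMeasure μ).prod (expSeq μ)).map (fun p => seqCons p.1 p.2) = expSeq μ := by
  have := isProbabilityMeasure_expMeasure hμ
  have := isProbabilityMeasure_expSeq hμ
  refine Measure.eq_infinitePi _ fun F t ht => ?_
  classical
  rw [Measure.map_apply measurable_seqCons (MeasurableSet.pi F.countable_toSet fun i _ => ht i)]
  let G : Finset ℕ := F.preimage Nat.succ (Nat.succ_injective.injOn)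
  have hset : (fun p : ℝ × (ℕ → ℝ) => seqCons p.1 p.2) ⁻¹' (Set.pi F t) =
      (if 0 ∈ F then t 0 else Set.univ) ×ˢ (Set.pi G fun i => t (i + 1)) := by
    ext ⟨x, s⟩
    simp only [Set.mem_preimage, Set.mem_pi, Set.mem_prod, G, Finset.coe_preimage,
      Finset.mem_coe]
    constructor
    · intro h
      refine ⟨?_, fun i hi => h (i + 1) hi⟩
      split_ifs with h0
      · exact h 0 h0
      · trivial
    · rintro ⟨h0, h1⟩ i hi
      cases i with
      | zero => rw [if_pos hi] at h0; exact h0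
      | succ i => exact h1 i hi
  rw [hset, Measure.prod_prod, expSeq, Measure.infinitePi_pi _ fun i _ => ht (i + 1)]
  have hG : ∏ i ∈ G, expMeasure μ (t (i + 1)) = ∏ i ∈ F.erase 0, expMeasure μ (t i) := by
    refine Finset.prod_bij (fun i _ => i + 1) ?_ ?_ ?_ ?_
    · intro i hi
      simpa [G] using hi
    · intro i _ j _ h
      simpa using h
    · intro j hj
      rw [Finset.mem_erase] at hj
      exact ⟨j - 1, by simpa [G, Nat.sub_add_cancel (Nat.pos_of_ne_zero hj.1)] using hj.2,
        Nat.sub_add_cancel (Nat.pos_of_ne_zero hj.1)⟩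
    · intros; rfl
  rw [hG]
  split_ifs with h0
  · exact Finset.mul_prod_erase F (fun i => expMeasure μ (t i)) h0
  · rw [Finset.erase_eq_of_notMem h0, measure_univ, one_mul]

lemma expSeq_apply {μ : ℝ} (hμ : 0 < μ) {A : Set (ℕ → ℝ)} (hA : MeasurableSet A) :
    expSeq μ A = ∫⁻ x, expSeq μ (seqCons x ⁻¹' A) ∂(expMeasure μ) := by
  have := isProbabilityMeasure_expSeq hμ
  conv_lhs => rw [← map_seqCons_expSeq hμ, Measure.map_apply measurable_seqCons hA,
    Measure.prod_apply (measurable_seqCons hA)]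
  rfl

lemma measurable_expSeq_seqCons {μ : ℝ} (hμ : 0 < μ) {A : Set (ℕ → ℝ)} (hA : MeasurableSet A) :
    Measurable fun x => expSeq μ (seqCons x ⁻¹' A) :=
  have := isProbabilityMeasure_expSeq hμ
  measurable_measure_prodMk_left (measurable_seqCons hA)

lemma lintegral_expMeasure {μ : ℝ} {f : ℝ → ENNReal} (hf : Measurable f) :
    ∫⁻ x, f x ∂(expMeasure μ) =
      ∫⁻ x in Set.Ici 0, ENNReal.ofReal (μ * Real.exp (-(μ * x))) * f x := by
  have hm : Measurable (gammaPDF 1 μ) := (measurable_gammaPDFReal 1 μ).ennreal_ofReal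
  rw [expMeasure, gammaMeasure, lintegral_withDensity_eq_lintegral_mul _ hm hf,
    ← lintegral_indicator measurableSet_Ici]
  refine lintegral_congr fun x => ?_
  have := exponentialPDF_eq μ x
  rw [show exponentialPDF μ x = gammaPDF 1 μ x from rfl] at this
  by_cases hx : 0 ≤ x <;> simp [this, hx]

lemma ae_expMeasure_pos {μ : ℝ} : ∀ᵐ x ∂(expMeasure μ), 0 < x := by
  rw [ae_iff]
  have h : {x : ℝ | ¬ 0 < x} = Set.Iic 0 := by ext x; simp
  rw [h, ← lintegral_indicator_one measurableSet_Iic,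
    lintegral_expMeasure (measurable_one.indicator measurableSet_Iic),
    ← lintegral_indicator measurableSet_Ici]
  rw [lintegral_eq_zero_iff' (by
    refine (Measurable.indicator ?_ measurableSet_Ici).aemeasurable
    exact (by fun_prop : Measurable fun x : ℝ => ENNReal.ofReal (μ * Real.exp (-(μ * x)))).mul
      (measurable_one.indicator measurableSet_Iic))]
  filter_upwards [Measure.ae_ne volume (0 : ℝ)] with x hx
  rcases lt_or_gt_of_ne hx with h | h
  · simp [h]
  · simp [h]

/-- Lack of memory of the exponential distribution. -/
lemma setLIntegral_expMeasure_sub {μ c : ℝ} (hc : 0 ≤ c) {f : ℝ → ENNReal}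
    (hf : Measurable f) :
    ∫⁻ x in Set.Ioi c, f (x - c) ∂(expMeasure μ) =
      ENNReal.ofReal (Real.exp (-(μ * c))) * ∫⁻ x, f x ∂(expMeasure μ) := by
  have hg : Measurable (fun x : ℝ => (Set.Ioi c).indicator (fun x => f (x - c)) x) :=
    (hf.comp (measurable_id.sub_const c)).indicator measurableSet_Ioi
  rw [← lintegral_indicator measurableSet_Ioi, lintegral_expMeasure hg, lintegral_expMeasure hf,
    ← lintegral_const_mul _ (by fun_prop), setLIntegral_congr Ioi_ae_eq_Ici.symm,
    setLIntegral_congr Ioi_ae_eq_Ici.symm, ← lintegral_indicator measurableSet_Ioi,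
    ← lintegral_indicator measurableSet_Ioi,
    ← lintegral_add_right_eq_self _ c]
  refine lintegral_congr fun x => ?_
  by_cases hx : 0 < x
  · have h1 : x + c ∈ Set.Ioi (0 : ℝ) := by simp; linarith
    have h2 : x + c ∈ Set.Ioi c := by simpa using hx
    rw [Set.indicator_of_mem h1, Set.indicator_of_mem h2, Set.indicator_of_mem (Set.mem_Ioi.2 hx),
      add_sub_cancel_right, ← mul_assoc, ← ENNReal.ofReal_mul (Real.exp_pos _).le]
    congr 2
    rw [mul_left_comm, ← Real.exp_add]
    congr 2
    ring
  · have h2 : x + c ∉ Set.Ioi c := by simpa using hx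
    rw [Set.indicator_of_notMem (s := Set.Ioi 0) (a := x) (by simpa using hx)]
    simp [Set.indicator_of_notMem h2]

/-- Induction on `n`: removing the first service time `x` replaces `(c, n + 1)` by `(c - x, n)`, and
`n = 0` is lack of memory. Since `c - x` may be negative, `c` ranges over all reals; the stage with
`n = 0` is then empty. -/
lemma expSeq_stage_inter {μ : ℝ} (hμ : 0 < μ) {B : Set (ℕ → ℝ)} (hB : MeasurableSet B) (n : ℕ) :
    ∀ (c : ℝ) {A : Set (ℕ → ℝ)}, MeasurableSet A →
      (∀ s s' : ℕ → ℝ, (∀ i < n, s i = s' i) → (s ∈ A ↔ s' ∈ A)) →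
      expSeq μ (stage c n ∩ A ∩ residualSeq c n ⁻¹' B) = expSeq μ (stage c n ∩ A) * expSeq μ B := by
  have := isProbabilityMeasure_expSeq hμ
  induction n with
  | zero =>
    intro c A hA hAdep
    -- Here `A` depends on no coordinate at all.
    have hA' : A = ∅ ∨ A = Set.univ := by
      rcases A.eq_empty_or_nonempty with h | ⟨a, ha⟩
      · exact Or.inl h
      · exact Or.inr (Set.eq_univ_of_forall fun s => (hAdep s a (by simp)).2 ha)
    rcases hA' with rfl | rfl
    · simp
    simp only [Set.inter_univ]
    by_cases hc : 0 ≤ c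
    · have key : ∀ D : Set (ℕ → ℝ), MeasurableSet D →
          expSeq μ (stage c 0 ∩ residualSeq c 0 ⁻¹' D) =
            ENNReal.ofReal (Real.exp (-(μ * c))) * expSeq μ D := by
        intro D hD
        rw [expSeq_apply hμ ((measurableSet_stage c 0).inter (measurable_residualSeq c 0 hD)),
          expSeq_apply hμ hD, ← setLIntegral_expMeasure_sub hc
            (measurable_expSeq_seqCons hμ hD),
          ← lintegral_indicator measurableSet_Ioi]
        refine lintegral_congr fun x => ?_
        by_cases hx : c < x
        · rw [Set.indicator_of_mem (Set.mem_Ioi.2 hx)]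
          congr 1
          ext s
          simp [stage, recvTime_seqCons_zero, genTime_zero, hx, hc, residualSeq_seqCons_zero]
        · rw [Set.indicator_of_notMem (by simpa using hx)]
          convert measure_empty (μ := expSeq μ)
          ext s
          simp [stage, recvTime_seqCons_zero, hx]
      have h1 := key Set.univ MeasurableSet.univ
      simp only [Set.preimage_univ, Set.inter_univ, measure_univ, mul_one] at h1
      rw [key B hB, h1]
    · have : stage c 0 = ∅ := by
        ext s
        simp only [stage, genTime_zero, Set.mem_ofPred_eq, Set.mem_empty_iff_false, iff_false]
        exact fun h => hc h.1
      simp [this]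
  | succ n ih =>
    intro c A hA hAdep
    have hsec x : MeasurableSet (seqCons x ⁻¹' A) :=
      (measurable_seqCons.comp (measurable_prodMk_left (x := x))) hA
    rw [expSeq_apply hμ (((measurableSet_stage c (n + 1)).inter hA).inter
        (measurable_residualSeq c (n + 1) hB)),
      expSeq_apply hμ ((measurableSet_stage c (n + 1)).inter hA),
      ← lintegral_mul_const _ (measurable_expSeq_seqCons hμ
        ((measurableSet_stage c (n + 1)).inter hA))]
    refine lintegral_congr fun x => ?_
    have h1 : seqCons x ⁻¹' (stage c (n + 1)) = stage (c - x) n := by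
      ext s; exact seqCons_mem_stage_succ c x s n
    have h2 : seqCons x ⁻¹' (residualSeq c (n + 1) ⁻¹' B) = residualSeq (c - x) n ⁻¹' B := by
      ext s; simp [residualSeq_seqCons_succ]
    rw [Set.preimage_inter, Set.preimage_inter, h1, h2]
    refine ih (c - x) (hsec x) fun s s' h => hAdep _ _ fun i hi => ?_
    cases i with
    | zero => rfl
    | succ i => exact h i (by omega)

lemma ae_expSeq_pos {μ : ℝ} (hμ : 0 < μ) : ∀ᵐ s ∂(expSeq μ), ∀ i, 0 < s i := by
  have := isProbabilityMeasure_expMeasure hμ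
  rw [ae_all_iff]
  intro i
  have h := ae_expMeasure_pos (μ := μ)
  rw [← Measure.infinitePi_map_eval (fun _ : ℕ => expMeasure μ) i] at h
  exact ae_of_ae_map (measurable_pi_apply i).aemeasurable h

/-! ### Poisson law of the number of updates received by a fixed time -/

lemma poissonProb_nonneg {r : ℝ} (hr : 0 ≤ r) (k : ℕ) : 0 ≤ poissonProb r k := by
  unfold poissonProb; positivity

lemma poissonProb_pos {r : ℝ} (hr : 0 < r) (k : ℕ) : 0 < poissonProb r k := by
  unfold poissonProb; positivity

lemma hasSum_poissonProb (r : ℝ) : HasSum (poissonProb r) 1 := by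
  have h := (NormedSpace.expSeries_div_hasSum_exp r).mul_right (Real.exp (-r))
  rwa [← Real.exp_eq_exp_ℝ, ← Real.exp_add, add_neg_cancel, Real.exp_zero] at h

/-- Induction step for the Poisson law: a first reception at `x` leaves `n` more for the remaining
time `c - x`. The exponentials combine to `e^{-μc}`, so only `(c - x)^n` is integrated. -/
lemma integral_exp_mul_poissonProb (μ c : ℝ) (n : ℕ) :
    ∫ x in (0 : ℝ)..c, μ * Real.exp (-(μ * x)) * poissonProb (μ * (c - x)) n =
      poissonProb (μ * c) (n + 1) := by
  have h : ∀ x : ℝ, μ * Real.exp (-(μ * x)) * poissonProb (μ * (c - x)) n =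
      μ ^ (n + 1) * Real.exp (-(μ * c)) / n.factorial * (c - x) ^ n := by
    intro x
    have : Real.exp (-(μ * c)) = Real.exp (-(μ * x)) * Real.exp (-(μ * (c - x))) := by
      rw [← Real.exp_add]; congr 1; ring
    rw [poissonProb, this, mul_pow]
    ring
  simp_rw [h]
  rw [intervalIntegral.integral_const_mul,
    intervalIntegral.integral_comp_sub_left (fun x => x ^ n) c, integral_pow, poissonProb,
    Nat.factorial_succ]
  push_cast
  field_simp
  simp [mul_pow]

lemma expSeq_stage {μ : ℝ} (hμ : 0 < μ) (n : ℕ) (c : ℝ) :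
    expSeq μ (stage c n) = if 0 ≤ c then ENNReal.ofReal (poissonProb (μ * c) n) else 0 := by
  have := isProbabilityMeasure_expSeq hμ
  have := isProbabilityMeasure_expMeasure hμ
  induction n generalizing c with
  | zero =>
    rw [expSeq_apply hμ (measurableSet_stage c 0)]
    split_ifs with hc
    · have h := setLIntegral_expMeasure_sub (μ := μ) hc (f := fun _ => 1) measurable_const
      simp only [lintegral_one, measure_univ, mul_one] at h
      rw [poissonProb, pow_zero, Nat.factorial_zero, Nat.cast_one, div_one, one_mul, ← h,
        Measure.restrict_apply_univ, ← lintegral_indicator_one measurableSet_Ioi]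
      refine lintegral_congr fun x => ?_
      by_cases hx : c < x
      · rw [Set.indicator_of_mem (Set.mem_Ioi.2 hx)]
        refine Eq.trans ?_ (measure_univ (μ := expSeq μ))
        congr 1
        ext s
        simp [stage, recvTime_seqCons_zero, genTime_zero, hx, hc]
      · rw [Set.indicator_of_notMem (by simpa using hx)]
        convert measure_empty (μ := expSeq μ)
        ext s
        simp [stage, recvTime_seqCons_zero, hx]
    · rw [lintegral_eq_zero_iff' (measurable_expSeq_seqCons hμ
        (measurableSet_stage c 0)).aemeasurable]
      refine Eventually.of_forall fun x => ?_
      refine Eq.trans (congrArg (expSeq μ) ?_) (measure_empty (μ := expSeq μ))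
      ext s
      simp only [stage, genTime_zero, Set.mem_preimage, Set.mem_ofPred_eq,
        Set.mem_empty_iff_false, iff_false]
      exact fun h => hc h.1
  | succ n ih =>
    have h1 x : seqCons x ⁻¹' (stage c (n + 1)) = stage (c - x) n := by
      ext s; exact seqCons_mem_stage_succ c x s n
    have hmeas := measurable_expSeq_seqCons hμ (measurableSet_stage c (n + 1))
    rw [expSeq_apply hμ (measurableSet_stage c (n + 1)), lintegral_expMeasure hmeas]
    simp_rw [h1, ih]
    split_ifs with hc
    · rw [← integral_exp_mul_poissonProb, intervalIntegral.integral_of_le hc,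
        ofReal_integral_eq_lintegral_ofReal, setLIntegral_congr Ioi_ae_eq_Ici.symm,
        ← lintegral_indicator measurableSet_Ioi, ← lintegral_indicator measurableSet_Ioc]
      · refine lintegral_congr fun x => ?_
        by_cases hx : 0 < x
        · by_cases hxc : x ≤ c
          · simp [hx, hxc, ENNReal.ofReal_mul (mul_pos hμ (Real.exp_pos _)).le]
          · simp [hxc]
        · simp [hx]
      · have hcont : Continuous fun x : ℝ =>
            μ * Real.exp (-(μ * x)) * poissonProb (μ * (c - x)) n := by
          unfold poissonProb; fun_prop
        exact (hcont.integrableOn_Icc).mono_set Set.Ioc_subset_Icc_self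
      · filter_upwards [ae_restrict_mem measurableSet_Ioc] with x hx
        have := poissonProb_nonneg (mul_nonneg hμ.le (sub_nonneg.2 hx.2)) n
        simp only [Pi.zero_apply]
        positivity
    · rw [setLIntegral_congr_fun measurableSet_Ici (g := fun _ => 0), lintegral_zero]
      intro x hx
      have : ¬ 0 ≤ c - x := by
        have : (0 : ℝ) ≤ x := hx
        linarith
      simp only [if_neg this, mul_zero]

lemma aedisjoint_stage {μ : ℝ} (hμ : 0 < μ) (c : ℝ) :
    Pairwise (Function.onFun (AEDisjoint (expSeq μ)) (stage c)) := by
  intro m n hmn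
  have : ∀ᵐ s ∂(expSeq μ), s ∉ stage c m ∩ stage c n := by
    filter_upwards [ae_expSeq_pos hμ] with s hs hmem
    exact hmn (stage_unique (fun i => (hs i).le) hmem.1 hmem.2)
  exact measure_eq_zero_iff_ae_notMem.2 this

/-- Receptions do not accumulate before `c`, because the Poisson weights of the stages already sum
to one. -/
lemma ae_exists_mem_stage {μ : ℝ} (hμ : 0 < μ) {c : ℝ} (hc : 0 ≤ c) :
    ∀ᵐ s ∂(expSeq μ), s ∈ ⋃ n, stage c n := by
  have := isProbabilityMeasure_expSeq hμ
  refine (mem_ae_iff_prob_eq_one₀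
    (MeasurableSet.iUnion fun n => measurableSet_stage c n).nullMeasurableSet).2 ?_
  rw [measure_iUnion₀ (aedisjoint_stage hμ c) fun n => (measurableSet_stage c n).nullMeasurableSet]
  have h := hasSum_poissonProb (μ * c)
  simp_rw [expSeq_stage hμ, if_pos hc]
  rw [← ENNReal.ofReal_tsum_of_nonneg (poissonProb_nonneg (by positivity)) h.summable, h.tsum_eq,
    ENNReal.ofReal_one]

lemma expSeq_eq_tsum_stage_inter {μ : ℝ} (hμ : 0 < μ) {c : ℝ} (hc : 0 ≤ c) (X : Set (ℕ → ℝ)) :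
    expSeq μ X = ∑' n, expSeq μ (stage c n ∩ X) := by
  conv_lhs => rw [← Measure.restrict_eq_self_of_ae_mem (ae_exists_mem_stage hμ hc),
    Measure.restrict_iUnion_ae (aedisjoint_stage hμ c)
      fun n => (measurableSet_stage c n).nullMeasurableSet, Measure.sum_apply_of_countable]
  simp_rw [Measure.restrict_apply' (measurableSet_stage c _), Set.inter_comm X]

/-- Membership in `A` depends only on the updates received up to time `c`. -/
def DeterminedBefore (c : ℝ) (A : Set (ℕ → ℝ)) : Prop :=
  ∀ (n : ℕ) (s s' : ℕ → ℝ), (∀ i, 0 < s i) → (∀ i, 0 < s' i) → s ∈ stage c n → s' ∈ stage c n →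
    (∀ i < n, s i = s' i) → (s ∈ A ↔ s' ∈ A)

/-- Membership in `B'` means that the service times seen after time `c` lie in `B`. -/
def IsShiftOf (c : ℝ) (B' B : Set (ℕ → ℝ)) : Prop :=
  ∀ (n : ℕ) (s : ℕ → ℝ), (∀ i, 0 < s i) → s ∈ stage c n → (s ∈ B' ↔ residualSeq c n s ∈ B)

/-- The sequence which agrees with `s` before index `n` and is constant from there on. -/
def seqFill (x : ℝ) (n : ℕ) (s : ℕ → ℝ) : ℕ → ℝ := fun i => if i < n then s i else x

lemma measurable_seqFill (x : ℝ) (n : ℕ) : Measurable (seqFill x n) :=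
  measurable_pi_iff.2 fun i => by
    unfold seqFill
    by_cases h : i < n <;> simp only [h, if_true, if_false] <;> fun_prop

/-- The Markov property of the updates at a fixed time. -/
theorem expSeq_inter_of_isShiftOf {μ : ℝ} (hμ : 0 < μ) {c : ℝ} (hc : 0 ≤ c)
    {A B B' : Set (ℕ → ℝ)} (hA : MeasurableSet A) (hAc : DeterminedBefore c A)
    (hB : MeasurableSet B) (hBc : IsShiftOf c B' B) :
    expSeq μ (A ∩ B') = expSeq μ A * expSeq μ B := by
  rw [expSeq_eq_tsum_stage_inter hμ hc, expSeq_eq_tsum_stage_inter hμ hc A, ← ENNReal.tsum_mul_right]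
  refine tsum_congr fun n => ?_
  -- `DeterminedBefore` constrains `A` only on positive sequences of the stage, while
  -- `expSeq_stage_inter` wants dependence on the first `n` terms everywhere. Pulling `A` back along
  -- `seqFill` achieves this. The filler `c + 1` is positive and exceeds `c`, so the filled sequence
  -- stays in the stage.
  have hfill : ∀ s, (∀ i, 0 < s i) → s ∈ stage c n → (s ∈ A ↔ seqFill (c + 1) n s ∈ A) := by
    intro s hs hn
    have heq : ∀ i < n, s i = seqFill (c + 1) n s i := fun i hi => by simp [seqFill, hi]
    refine hAc n s _ hs (fun i => ?_) hn ?_ heq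
    · simp only [seqFill]
      split_ifs
      · exact hs i
      · positivity
    · have hg := genTime_congr heq
      have h0 := genTime_nonneg (fun i => (hs i).le) n
      refine ⟨hg ▸ hn.1, ?_⟩
      rw [recvTime, ← hg]
      simp only [seqFill, lt_irrefl, if_false]
      linarith
  have h1 : expSeq μ (stage c n ∩ (A ∩ B')) =
      expSeq μ (stage c n ∩ (seqFill (c + 1) n ⁻¹' A) ∩ residualSeq c n ⁻¹' B) := by
    refine measure_congr ?_
    filter_upwards [ae_expSeq_pos hμ] with s hs
    refine propext ?_
    change s ∈ stage c n ∩ (A ∩ B') ↔ s ∈ stage c n ∩ _ ∩ _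
    simp only [Set.mem_inter_iff, Set.mem_preimage, and_assoc]
    refine and_congr_right fun hn => ?_
    rw [hfill s hs hn, hBc n s hs hn]
  have h2 : expSeq μ (stage c n ∩ A) = expSeq μ (stage c n ∩ (seqFill (c + 1) n ⁻¹' A)) := by
    refine measure_congr ?_
    filter_upwards [ae_expSeq_pos hμ] with s hs
    refine propext ?_
    change s ∈ stage c n ∩ A ↔ s ∈ stage c n ∩ _
    simp only [Set.mem_inter_iff, Set.mem_preimage]
    exact and_congr_right fun hn => hfill s hs hn
  rw [h1, h2]
  refine expSeq_stage_inter hμ hB n c (measurable_seqFill _ _ hA) fun s s' h => ?_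
  have : seqFill (c + 1) n s = seqFill (c + 1) n s' := by
    funext i
    by_cases hi : i < n <;> simp [seqFill, hi, h]
  simp [this]

/-- Stationarity: the Markov property with the past event taken to be everything. -/
lemma expSeq_of_isShiftOf {μ : ℝ} (hμ : 0 < μ) {c : ℝ} (hc : 0 ≤ c) {B B' : Set (ℕ → ℝ)}
    (hB : MeasurableSet B) (hBc : IsShiftOf c B' B) : expSeq μ B' = expSeq μ B := by
  have := isProbabilityMeasure_expSeq hμ
  have h := expSeq_inter_of_isShiftOf hμ hc MeasurableSet.univ
    (fun _ _ _ _ _ _ _ _ => Iff.rfl) hB hBc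
  rwa [Set.univ_inter, measure_univ, one_mul] at h

/-! ### Numbers of received updates -/

lemma setOf_recvTime_mem_eq {s : ℕ → ℝ} (hs : ∀ i, 0 ≤ s i) {a d : ℝ} {n : ℕ}
    (h : s ∈ stage d n) {b : ℝ} (hb : b ≤ d) :
    {i | a < recvTime s i ∧ recvTime s i ≤ b} =
      {i | i < n ∧ a < recvTime s i ∧ recvTime s i ≤ b} := by
  ext i
  simp only [Set.mem_ofPred_eq]
  exact ⟨fun hi => ⟨(recvTime_le_iff_of_mem_stage hs h i).1 (hi.2.trans hb), hi⟩, fun hi => hi.2⟩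

lemma numReceived_zero_of_mem_stage {s : ℕ → ℝ} (hs : ∀ i, 0 < s i) {c : ℝ} {n : ℕ}
    (h : s ∈ stage c n) : numReceived s 0 c = n := by
  have : {i | 0 < recvTime s i ∧ recvTime s i ≤ c} = ((Finset.range n : Finset ℕ) : Set ℕ) := by
    ext i
    simp [recvTime_pos hs i, recvTime_le_iff_of_mem_stage (fun i => (hs i).le) h i]
  rw [numReceived, this, Set.encard_coe_eq_coe_finsetCard, Finset.card_range]

lemma numReceived_ne_top {s : ℕ → ℝ} (hs : ∀ i, 0 ≤ s i) {a b : ℝ} {n : ℕ} (h : s ∈ stage b n) :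
    numReceived s a b ≠ ⊤ := by
  rw [numReceived, setOf_recvTime_mem_eq hs h le_rfl, Set.encard_ne_top_iff]
  exact (Set.finite_lt_nat n).subset fun i hi => hi.1

/-- The count is `k` iff the index set is one of the countably many finite sets of cardinality `k`.
-/
lemma measurableSet_numReceived (a b : ℝ) (k : ℕ) :
    MeasurableSet {s : ℕ → ℝ | numReceived s a b = k} := by
  have h : {s : ℕ → ℝ | numReceived s a b = k} = ⋃ F : {F : Finset ℕ // F.card = k},
      ⋂ i, {s | i ∈ F.1 ↔ a < recvTime s i ∧ recvTime s i ≤ b} := by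
    ext s
    simp only [Set.mem_iUnion, Set.mem_iInter, Set.mem_ofPred_eq, numReceived]
    constructor
    · intro hk
      have hfin := Set.finite_of_encard_eq_coe hk
      refine ⟨⟨hfin.toFinset, ?_⟩, fun i => by simp⟩
      rw [hfin.encard_eq_coe_toFinset_card] at hk
      exact_mod_cast hk
    · rintro ⟨⟨F, hF⟩, h⟩
      have : {i | a < recvTime s i ∧ recvTime s i ≤ b} = (F : Set ℕ) := by
        ext i; exact (h i).symm
      rw [this, Set.encard_coe_eq_coe_finsetCard, hF]
  rw [h]
  refine MeasurableSet.iUnion fun F => MeasurableSet.iInter fun i => ?_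
  have hm : MeasurableSet {s : ℕ → ℝ | a < recvTime s i ∧ recvTime s i ≤ b} :=
    (measurableSet_lt measurable_const (measurable_recvTime i)).inter
      (measurableSet_le (measurable_recvTime i) measurable_const)
  by_cases hi : i ∈ F.1
  · simpa [hi] using hm
  · simp only [hi, false_iff]
    exact hm.compl

lemma determinedBefore_numReceived {a b d : ℝ} (hb : b ≤ d) (k : ℕ) :
    DeterminedBefore d {s | numReceived s a b = k} := by
  intro n s s' hs hs' hn hn' h
  simp only [Set.mem_ofPred_eq, numReceived]
  rw [setOf_recvTime_mem_eq (fun i => (hs i).le) hn hb,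
    setOf_recvTime_mem_eq (fun i => (hs' i).le) hn' hb]
  have : {i | i < n ∧ a < recvTime s i ∧ recvTime s i ≤ b} =
      {i | i < n ∧ a < recvTime s' i ∧ recvTime s' i ≤ b} := by
    ext i
    simp only [Set.mem_ofPred_eq]
    exact and_congr_right fun hi => by rw [recvTime_congr h hi]
  rw [this]

lemma isShiftOf_numReceived {a b : ℝ} (k : ℕ) :
    IsShiftOf a {s | numReceived s a b = k} {s | numReceived s 0 (b - a) = k} := by
  intro n s hs hn
  simp only [Set.mem_ofPred_eq, numReceived]
  have : {i | a < recvTime s i ∧ recvTime s i ≤ b} = (fun i => n + i) ''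
      {i | 0 < recvTime (residualSeq a n s) i ∧ recvTime (residualSeq a n s) i ≤ b - a} := by
    ext i
    simp only [Set.mem_ofPred_eq, Set.mem_image, recvTime_residualSeq, sub_pos,
      sub_le_sub_iff_right]
    constructor
    · intro hi
      have : n ≤ i := by
        by_contra! h
        exact absurd ((recvTime_le_iff_of_mem_stage (fun i => (hs i).le) hn i).2 h)
          (not_le.2 hi.1)
      exact ⟨i - n, by rwa [Nat.add_sub_cancel' this], Nat.add_sub_cancel' this⟩
    · rintro ⟨j, hj, rfl⟩
      exact hj
  rw [this, Function.Injective.encard_image (add_right_injective n)]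

lemma expSeq_numReceived_zero {μ : ℝ} (hμ : 0 < μ) {c : ℝ} (hc : 0 ≤ c) (k : ℕ) :
    expSeq μ {s | numReceived s 0 c = k} = ENNReal.ofReal (poissonProb (μ * c) k) := by
  have h := expSeq_stage hμ k c
  rw [if_pos hc] at h
  rw [← h]
  refine measure_congr ?_
  filter_upwards [ae_expSeq_pos hμ, ae_exists_mem_stage hμ hc] with s hs hex
  obtain ⟨n, hn⟩ := Set.mem_iUnion.1 hex
  refine propext ?_
  change numReceived s 0 c = k ↔ s ∈ stage c k
  constructor
  · intro hk
    rw [numReceived_zero_of_mem_stage hs hn] at hk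
    have : n = k := by exact_mod_cast hk
    exact this ▸ hn
  · exact numReceived_zero_of_mem_stage hs

lemma expSeq_numReceived {μ : ℝ} (hμ : 0 < μ) {a b : ℝ} (ha : 0 ≤ a) (hab : a ≤ b) (k : ℕ) :
    expSeq μ {s | numReceived s a b = k} = ENNReal.ofReal (poissonProb (μ * (b - a)) k) := by
  rw [expSeq_of_isShiftOf hμ ha (measurableSet_numReceived _ _ _) (isShiftOf_numReceived k),
    expSeq_numReceived_zero hμ (sub_nonneg.2 hab)]

lemma expSeq_numReceived_inter {μ : ℝ} (hμ : 0 < μ) {a b c : ℝ} (ha : 0 ≤ a) (hab : a ≤ b)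
    (hbc : b ≤ c) (k n : ℕ) :
    expSeq μ ({s | numReceived s a b = k} ∩ {s | numReceived s b c = n}) =
      ENNReal.ofReal (poissonProb (μ * (b - a)) k) *
        ENNReal.ofReal (poissonProb (μ * (c - b)) n) := by
  rw [expSeq_inter_of_isShiftOf hμ (ha.trans hab) (measurableSet_numReceived _ _ _)
    (determinedBefore_numReceived le_rfl k) (measurableSet_numReceived _ _ _)
    (isShiftOf_numReceived n), expSeq_numReceived hμ ha hab,
    expSeq_numReceived_zero hμ (sub_nonneg.2 hbc)]

/-! ### Time intervals with at most one received update -/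

/-- The service time sequences for which at most one update is received during `(r, t]`. -/
def fewReceived (r t : ℝ) : Set (ℕ → ℝ) := {s | ∀ i, recvTime s i ≤ r ∨ t < recvTime s (i + 1)}

/-- Measurability jointly in the path and the two times is what Tonelli needs later. -/
lemma measurableSet_fewReceived_prod :
    MeasurableSet {q : (ℕ → ℝ) × (ℝ × ℝ) | q.1 ∈ fewReceived q.2.2 q.2.1} := by
  have : {q : (ℕ → ℝ) × (ℝ × ℝ) | q.1 ∈ fewReceived q.2.2 q.2.1} =
      ⋂ i, ({q | recvTime q.1 i ≤ q.2.2} ∪ {q | q.2.1 < recvTime q.1 (i + 1)}) := by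
    ext q; simp [fewReceived]
  rw [this]
  refine MeasurableSet.iInter fun i => ?_
  exact (measurableSet_le ((measurable_recvTime i).comp measurable_fst)
    (measurable_snd.comp measurable_snd)).union
    (measurableSet_lt (measurable_fst.comp measurable_snd)
      ((measurable_recvTime (i + 1)).comp measurable_fst))

lemma measurableSet_fewReceived (r t : ℝ) : MeasurableSet (fewReceived r t) :=
  (measurable_prodMk_right (y := (t, r))) measurableSet_fewReceived_prod

lemma isShiftOf_fewReceived {c r : ℝ} (hr : c ≤ r) (t : ℝ) :
    IsShiftOf c (fewReceived r t) (fewReceived (r - c) (t - c)) := by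
  intro n s hs hn
  simp only [fewReceived, Set.mem_ofPred_eq, recvTime_residualSeq, sub_le_sub_iff_right,
    sub_lt_sub_iff_right]
  refine ⟨fun h i => h (n + i), fun h i => ?_⟩
  rcases lt_or_ge i n with hi | hi
  · exact Or.inl (((recvTime_le_iff_of_mem_stage (fun i => (hs i).le) hn i).2 hi).trans hr)
  · obtain ⟨j, rfl⟩ := Nat.exists_eq_add_of_le hi
    exact h j

lemma determinedBefore_fewReceived {t d : ℝ} (ht : t ≤ d) (r : ℝ) :
    DeterminedBefore d (fewReceived r t) := by
  have key : ∀ (n : ℕ) (s s' : ℕ → ℝ), (∀ i, 0 < s' i) → s' ∈ stage d n →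
      (∀ i < n, s i = s' i) → s ∈ fewReceived r t → s' ∈ fewReceived r t := by
    intro n s s' hs' hn' h hmem i
    by_cases hi : i + 1 < n
    · rw [← recvTime_congr h hi, ← recvTime_congr h (by omega : i < n)]
      exact hmem i
    · refine Or.inr (ht.trans_lt ?_)
      by_contra! hle
      exact hi ((recvTime_le_iff_of_mem_stage (fun i => (hs' i).le) hn' (i + 1)).1 hle)
  intro n s s' hs hs' hn hn' h
  exact ⟨key n s s' hs' hn' h, key n s' s hs hn fun i hi => (h i hi).symm⟩

/-- By stationarity `r` may be moved to `0`; then the event is the union of stages `0` and `1`, with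
Poisson weights for zero and one reception. -/
lemma expSeq_fewReceived {μ : ℝ} (hμ : 0 < μ) {r t : ℝ} (hr : 0 ≤ r) (hrt : r ≤ t) :
    expSeq μ (fewReceived r t) =
      ENNReal.ofReal ((1 + μ * (t - r)) * Real.exp (-(μ * (t - r)))) := by
  have hu : 0 ≤ t - r := sub_nonneg.2 hrt
  rw [expSeq_of_isShiftOf hμ hr (measurableSet_fewReceived _ _) (isShiftOf_fewReceived le_rfl t),
    sub_self]
  have h : expSeq μ (fewReceived 0 (t - r)) =
      expSeq μ (stage (t - r) 0 ∪ stage (t - r) 1) := by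
    refine measure_congr ?_
    filter_upwards [ae_expSeq_pos hμ] with s hs
    refine propext ?_
    change (∀ i, _) ↔ (_ ∧ _) ∨ (_ ∧ _)
    rw [genTime_zero, genTime_succ]
    constructor
    · intro h
      have h1 := (h 0).resolve_left (not_le.2 (recvTime_pos hs 0))
      rcases lt_or_ge (t - r) (recvTime s 0) with h2 | h2
      · exact Or.inl ⟨hu, h2⟩
      · exact Or.inr ⟨h2, h1⟩
    · intro h i
      have hmono := recvTime_mono (fun i => (hs i).le)
      rcases h with h | h
      · exact Or.inr (h.2.trans_le (hmono (Nat.zero_le _)))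
      · exact Or.inr (h.2.trans_le (hmono (by omega)))
  rw [h, measure_union₀ (measurableSet_stage _ _).nullMeasurableSet
    (aedisjoint_stage hμ _ zero_ne_one), expSeq_stage hμ, expSeq_stage hμ, if_pos hu, if_pos hu,
    ← ENNReal.ofReal_add (poissonProb_nonneg (by positivity) _)
      (poissonProb_nonneg (by positivity) _)]
  congr 1
  simp [poissonProb]
  ring

/-! ### The area below the age curve as the area of a planar region -/

/-- The points `(t, r)` with `c + T < t ≤ c + 2 T` and `c < r ≤ t` such that at most one update is
received during `(r, t]`. -/
def ageRegion (T c : ℝ) (s : ℕ → ℝ) : Set (ℝ × ℝ) :=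
  {p | (c + T < p.1 ∧ p.1 ≤ c + 2 * T) ∧ (c < p.2 ∧ p.2 ≤ p.1) ∧ s ∈ fewReceived p.2 p.1}

lemma measurableSet_ageRegion_prod (T c : ℝ) :
    MeasurableSet {q : (ℕ → ℝ) × (ℝ × ℝ) | q.2 ∈ ageRegion T c q.1} := by
  have h1 : MeasurableSet {q : (ℕ → ℝ) × (ℝ × ℝ) | (c + T < q.2.1 ∧ q.2.1 ≤ c + 2 * T) ∧
      (c < q.2.2 ∧ q.2.2 ≤ q.2.1)} := by
    have m1 : Measurable fun q : (ℕ → ℝ) × (ℝ × ℝ) => q.2.1 := by fun_prop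
    have m2 : Measurable fun q : (ℕ → ℝ) × (ℝ × ℝ) => q.2.2 := by fun_prop
    exact ((measurableSet_lt measurable_const m1).inter
      (measurableSet_le m1 measurable_const)).inter
      ((measurableSet_lt measurable_const m2).inter (measurableSet_le m2 m1))
  convert h1.inter measurableSet_fewReceived_prod using 1
  ext q
  simp [ageRegion, and_assoc]

lemma measurableSet_ageRegion (T c : ℝ) (s : ℕ → ℝ) : MeasurableSet (ageRegion T c s) :=
  measurable_prodMk_left (measurableSet_ageRegion_prod T c)

lemma measurable_volume_ageRegion (T c : ℝ) : Measurable fun s => volume (ageRegion T c s) :=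
  measurable_measure_prodMk_left (measurableSet_ageRegion_prod T c)

lemma volume_ageRegion_le (T c : ℝ) (s : ℕ → ℝ) :
    volume (ageRegion T c s) ≤ ENNReal.ofReal T * ENNReal.ofReal (2 * T) := by
  have hsub : ageRegion T c s ⊆ Set.Ioc (c + T) (c + 2 * T) ×ˢ Set.Ioc c (c + 2 * T) :=
    fun p hp => ⟨hp.1, hp.2.1.1, hp.2.1.2.trans hp.1.2⟩
  refine (measure_mono hsub).trans_eq ?_
  rw [Measure.volume_eq_prod, Measure.prod_prod, Real.volume_Ioc, Real.volume_Ioc]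
  congr 2 <;> ring

lemma volume_ageRegion_ne_top (T c : ℝ) (s : ℕ → ℝ) : volume (ageRegion T c s) ≠ ⊤ :=
  ((volume_ageRegion_le T c s).trans_lt
    (ENNReal.mul_lt_top ENNReal.ofReal_lt_top ENNReal.ofReal_lt_top)).ne

/-- Restarting the clock at `c` translates the region along the diagonal by `(c, c)`, which
preserves Lebesgue measure. -/
lemma volume_ageRegion_residualSeq (T : ℝ) {c : ℝ} {n : ℕ} {s : ℕ → ℝ} (hs : ∀ i, 0 < s i)
    (hn : s ∈ stage c n) {d : ℝ} (hd : c ≤ d) :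
    volume (ageRegion T (d - c) (residualSeq c n s)) = volume (ageRegion T d s) := by
  rw [← measure_preimage_add_right volume ((c, c) : ℝ × ℝ) (ageRegion T d s)]
  congr 1
  ext ⟨t, r⟩
  simp only [ageRegion, Set.mem_ofPred_eq, Set.mem_preimage, Prod.mk_add_mk]
  have e1 : (d - c + T < t ∧ t ≤ d - c + 2 * T) ↔ (d + T < t + c ∧ t + c ≤ d + 2 * T) := by
    constructor <;> rintro ⟨h1, h2⟩ <;> constructor <;> linarith
  have e2 : (d - c < r ∧ r ≤ t) ↔ (d < r + c ∧ r + c ≤ t + c) := by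
    constructor <;> rintro ⟨h1, h2⟩ <;> constructor <;> linarith
  rw [e1, e2]
  refine and_congr_right fun _ => and_congr_right fun h => ?_
  have := isShiftOf_fewReceived (hd.trans h.1.le) (t + c) n s hs hn
  rw [this, add_sub_cancel_right, add_sub_cancel_right]

lemma volume_ageRegion_congr (T : ℝ) {c d : ℝ} (hd : c + 2 * T ≤ d) {n : ℕ} {s s' : ℕ → ℝ}
    (hs : ∀ i, 0 < s i) (hs' : ∀ i, 0 < s' i) (hn : s ∈ stage d n) (hn' : s' ∈ stage d n)
    (h : ∀ i < n, s i = s' i) : volume (ageRegion T c s) = volume (ageRegion T c s') := by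
  congr 1
  ext ⟨t, r⟩
  simp only [ageRegion, Set.mem_ofPred_eq]
  refine and_congr_right fun ht => and_congr_right fun _ => ?_
  exact determinedBefore_fewReceived (ht.2.trans hd) r n s s' hs hs' hn hn' h

/-- The area below the age curve during the period `(c + T, c + 2 T]`. -/
noncomputable def ageArea (T c : ℝ) (s : ℕ → ℝ) : ℝ := (volume (ageRegion T c s)).toReal

lemma measurable_ageArea (T c : ℝ) : Measurable (ageArea T c) :=
  (measurable_volume_ageRegion T c).ennreal_toReal

lemma ageArea_nonneg (T c : ℝ) (s : ℕ → ℝ) : 0 ≤ ageArea T c s := ENNReal.toReal_nonneg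

lemma integrable_ageArea {μ : ℝ} (hμ : 0 < μ) (T c : ℝ) : Integrable (ageArea T c) (expSeq μ) := by
  have := isProbabilityMeasure_expSeq hμ
  refine Integrable.of_bound (measurable_ageArea T c).aestronglyMeasurable
    (ENNReal.ofReal T * ENNReal.ofReal (2 * T)).toReal (Eventually.of_forall fun s => ?_)
  rw [Real.norm_of_nonneg (ageArea_nonneg T c s)]
  exact ENNReal.toReal_mono (ENNReal.mul_lt_top ENNReal.ofReal_lt_top ENNReal.ofReal_lt_top).ne
    (volume_ageRegion_le T c s)

lemma isShiftOf_preimage_ageArea (T : ℝ) {c d : ℝ} (hd : c ≤ d) (B : Set ℝ) :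
    IsShiftOf c (ageArea T d ⁻¹' B) (ageArea T (d - c) ⁻¹' B) := by
  intro n s hs hn
  simp only [Set.mem_preimage, ageArea, volume_ageRegion_residualSeq T hs hn hd]

lemma identDistrib_ageArea {μ : ℝ} (hμ : 0 < μ) (T : ℝ) {c : ℝ} (hc : 0 ≤ c) :
    IdentDistrib (ageArea T c) (ageArea T 0) (expSeq μ) (expSeq μ) where
  aemeasurable_fst := (measurable_ageArea T c).aemeasurable
  aemeasurable_snd := (measurable_ageArea T 0).aemeasurable
  map_eq := by
    ext B hB
    rw [Measure.map_apply (measurable_ageArea T c) hB,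
      Measure.map_apply (measurable_ageArea T 0) hB]
    have h := isShiftOf_preimage_ageArea T (le_refl c) B
    rw [sub_self] at h
    exact expSeq_of_isShiftOf hμ hc (measurable_ageArea T 0 hB) h

/-- The first area is settled by receptions up to `c + 2T ≤ d`, the second by the residual sequence
after `d`, so the Markov property at `d` applies. The offset `d - d` below is that of a system
restarted at `d`. -/
lemma indepFun_ageArea {μ : ℝ} (hμ : 0 < μ) {T : ℝ} (hT : 0 ≤ T) {c d : ℝ} (hc : 0 ≤ c)
    (hcd : c + 2 * T ≤ d) : IndepFun (ageArea T c) (ageArea T d) (expSeq μ) := by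
  have hd : 0 ≤ d := by linarith
  rw [indepFun_iff_measure_inter_preimage_eq_mul]
  intro A B hA hB
  have h := isShiftOf_preimage_ageArea T (le_refl d) B
  rw [expSeq_of_isShiftOf hμ hd (measurable_ageArea T (d - d) hB) h]
  refine expSeq_inter_of_isShiftOf hμ hd (measurable_ageArea T c hA) ?_
    (measurable_ageArea T (d - d) hB) h
  intro n s s' hs hs' hn hn' hss
  simp only [Set.mem_preimage, ageArea, volume_ageRegion_congr T hcd hs hs' hn hn' hss]

/-! ### The mean area -/

lemma integral_one_add_mul_exp {μ : ℝ} (hμ : μ ≠ 0) (t : ℝ) :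
    ∫ r in (0 : ℝ)..t, (1 + μ * (t - r)) * Real.exp (-(μ * (t - r))) =
      2 / μ - Real.exp (-(μ * t)) * (2 / μ + t) := by
  rw [intervalIntegral.integral_comp_sub_left
    (fun x => (1 + μ * x) * Real.exp (-(μ * x))) t, sub_self, sub_zero,
    intervalIntegral.integral_eq_sub_of_hasDerivAt
      (f := fun x => -(Real.exp (-(μ * x)) * (2 / μ + x)))]
  · simp; ring
  · intro x _
    have h := (((((hasDerivAt_id x).const_mul μ).neg).exp).mul
      ((hasDerivAt_id x).const_add (2 / μ))).neg
    refine h.congr_deriv ?_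
    simp only [Pi.neg_apply, id]
    field_simp
    ring
  · exact Continuous.intervalIntegrable (by fun_prop) _ _

lemma integral_two_div_sub_exp {μ : ℝ} (hμ : μ ≠ 0) (a b : ℝ) :
    ∫ t in a..b, (2 / μ - Real.exp (-(μ * t)) * (2 / μ + t)) =
      2 / μ * (b - a) + (Real.exp (-(μ * b)) * (b / μ + 3 / μ ^ 2) -
        Real.exp (-(μ * a)) * (a / μ + 3 / μ ^ 2)) := by
  rw [intervalIntegral.integral_eq_sub_of_hasDerivAt
      (f := fun x => 2 / μ * x + Real.exp (-(μ * x)) * (x / μ + 3 / μ ^ 2))]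
  · ring
  · intro x _
    have h := ((hasDerivAt_id x).const_mul (2 / μ)).add (((((hasDerivAt_id x).const_mul μ).neg).exp).mul
      (((hasDerivAt_id x).div_const μ).add_const (3 / μ ^ 2)))
    refine h.congr_deriv ?_
    simp only [Pi.neg_apply, id]
    field_simp
    ring
  · exact Continuous.intervalIntegrable (by fun_prop) _ _

/-- Tonelli exchanges the expectation with the planar measure; each point `(t, r)` then contributes
the probability of at most one reception in `(r, t]`, and the `r`-integral is
`integral_one_add_mul_exp`. -/
lemma lintegral_volume_ageRegion {μ T : ℝ} (hμ : 0 < μ) (hT : 0 < T) :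
    ∫⁻ s, volume (ageRegion T 0 s) ∂(expSeq μ) =
      ENNReal.ofReal (∫ t in T..(2 * T), (2 / μ - Real.exp (-(μ * t)) * (2 / μ + t))) := by
  have := isProbabilityMeasure_expSeq hμ
  have hR := measurableSet_ageRegion_prod T 0
  have hin : ∀ t : ℝ, 0 ≤ t → ENNReal.ofReal (2 / μ - Real.exp (-(μ * t)) * (2 / μ + t)) =
      ∫⁻ r in Set.Ioc 0 t, ENNReal.ofReal ((1 + μ * (t - r)) * Real.exp (-(μ * (t - r)))) := by
    intro t ht
    rw [← integral_one_add_mul_exp hμ.ne', intervalIntegral.integral_of_le ht,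
      ofReal_integral_eq_lintegral_ofReal]
    · exact ((by fun_prop : Continuous fun r : ℝ =>
        (1 + μ * (t - r)) * Real.exp (-(μ * (t - r)))).integrableOn_Icc).mono_set
          Set.Ioc_subset_Icc_self
    · filter_upwards [ae_restrict_mem measurableSet_Ioc] with r hr
      have : 0 ≤ μ * (t - r) := mul_nonneg hμ.le (sub_nonneg.2 hr.2)
      simp only [Pi.zero_apply]
      positivity
  have hnn : ∀ t : ℝ, 0 ≤ t → 0 ≤ 2 / μ - Real.exp (-(μ * t)) * (2 / μ + t) := by
    intro t ht
    rw [← integral_one_add_mul_exp hμ.ne']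
    refine intervalIntegral.integral_nonneg ht fun r hr => ?_
    have : 0 ≤ μ * (t - r) := mul_nonneg hμ.le (sub_nonneg.2 hr.2)
    positivity
  calc ∫⁻ s, volume (ageRegion T 0 s) ∂(expSeq μ)
      = ((expSeq μ).prod volume) {q : (ℕ → ℝ) × (ℝ × ℝ) | q.2 ∈ ageRegion T 0 q.1} := by
        rw [Measure.prod_apply hR]; rfl
    _ = ∫⁻ p : ℝ × ℝ, expSeq μ {s | p ∈ ageRegion T 0 s} := by
        rw [Measure.prod_apply_symm hR]; rfl
    _ = ∫⁻ t, ∫⁻ r, expSeq μ {s | (t, r) ∈ ageRegion T 0 s} := by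
        have hm : Measurable fun p : ℝ × ℝ => expSeq μ {s | p ∈ ageRegion T 0 s} :=
          measurable_measure_prodMk_right hR
        rw [Measure.volume_eq_prod, lintegral_prod _ hm.aemeasurable]
    _ = ∫⁻ t in Set.Ioc T (2 * T), ∫⁻ r in Set.Ioc 0 t,
          ENNReal.ofReal ((1 + μ * (t - r)) * Real.exp (-(μ * (t - r)))) := by
        rw [← lintegral_indicator measurableSet_Ioc]
        refine lintegral_congr fun t => ?_
        by_cases ht : t ∈ Set.Ioc T (2 * T)
        · rw [Set.indicator_of_mem ht, ← lintegral_indicator measurableSet_Ioc]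
          refine lintegral_congr fun r => ?_
          by_cases hr : r ∈ Set.Ioc 0 t
          · rw [Set.indicator_of_mem hr, ← expSeq_fewReceived hμ hr.1.le hr.2]
            congr 1
            ext s
            have := ht.1
            have := ht.2
            have := hr.1
            have := hr.2
            simp [ageRegion, *]
          · rw [Set.indicator_of_notMem hr]
            convert measure_empty (μ := expSeq μ)
            ext s
            simp only [ageRegion, Set.mem_ofPred_eq, Set.mem_empty_iff_false, iff_false]
            exact fun h => hr h.2.1
        · rw [Set.indicator_of_notMem ht, lintegral_eq_zero_of_ae_eq_zero]
          refine Eventually.of_forall fun r => ?_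
          refine Eq.trans (congrArg (expSeq μ) ?_) (measure_empty (μ := expSeq μ))
          ext s
          simp only [ageRegion, Set.mem_ofPred_eq, Set.mem_empty_iff_false, iff_false, zero_add]
          exact fun h => ht h.1
    _ = ∫⁻ t in Set.Ioc T (2 * T),
          ENNReal.ofReal (2 / μ - Real.exp (-(μ * t)) * (2 / μ + t)) := by
        refine setLIntegral_congr_fun measurableSet_Ioc fun t ht => ?_
        exact (hin t (hT.trans ht.1).le).symm
    _ = _ := by
        rw [intervalIntegral.integral_of_le (by linarith), ofReal_integral_eq_lintegral_ofReal]
        · exact ((by fun_prop : Continuous fun t : ℝ =>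
            2 / μ - Real.exp (-(μ * t)) * (2 / μ + t)).integrableOn_Icc).mono_set
              Set.Ioc_subset_Icc_self
        · filter_upwards [ae_restrict_mem measurableSet_Ioc] with t ht
          exact hnn t (hT.trans ht.1).le

lemma integral_ageArea_zero {μ T : ℝ} (hμ : 0 < μ) (hT : 0 < T) :
    (∫ s, ageArea T 0 s ∂(expSeq μ)) =
      T * ((3 + 2 * T * μ + Real.exp (T * μ) * (-3 + (-1 + 2 * Real.exp (T * μ)) * (T * μ)))
          / (T * μ ^ 2 * Real.exp (2 * (T * μ)))) := by
  have hnn : 0 ≤ ∫ t in T..(2 * T), (2 / μ - Real.exp (-(μ * t)) * (2 / μ + t)) := by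
    refine intervalIntegral.integral_nonneg (by linarith) fun t ht => ?_
    rw [← integral_one_add_mul_exp hμ.ne']
    refine intervalIntegral.integral_nonneg (hT.le.trans ht.1) fun r hr => ?_
    have : 0 ≤ μ * (t - r) := mul_nonneg hμ.le (sub_nonneg.2 hr.2)
    positivity
  unfold ageArea
  rw [integral_toReal (measurable_volume_ageRegion T 0).aemeasurable
    (Eventually.of_forall fun s => (volume_ageRegion_ne_top T 0 s).lt_top),
    lintegral_volume_ageRegion hμ hT, ENNReal.toReal_ofReal hnn,
    integral_two_div_sub_exp hμ.ne']
  have e2 : Real.exp (2 * (T * μ)) = Real.exp (T * μ) ^ 2 := by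
    rw [← Real.exp_nat_mul]; norm_num
  have e3 : Real.exp (-(μ * (2 * T))) = (Real.exp (T * μ) ^ 2)⁻¹ := by
    rw [Real.exp_neg, ← e2]; congr 2; ring
  have e4 : Real.exp (-(μ * T)) = (Real.exp (T * μ))⁻¹ := by
    rw [Real.exp_neg, mul_comm]
  rw [e2, e3, e4]
  have := Real.exp_pos (T * μ)
  field_simp
  ring

/-! ### The age along a path -/

lemma genTime_const (T : ℝ) (i : ℕ) : genTime (fun _ => T) i = i * T := by
  simp [genTime]

lemma recvTime_const (T : ℝ) (i : ℕ) : recvTime (fun _ => T) i = (i + 1) * T := by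
  rw [recvTime, genTime_const]; ring

/-- The generation time of the freshest information available at time `t`. -/
noncomputable def freshest (a₀ T : ℝ) (s : ℕ → ℝ) (t : ℝ) : ℝ :=
  sSup (receivedGenTimes a₀ s (fun _ => T) t)

lemma aoiMD_eq (a₀ T : ℝ) (s : ℕ → ℝ) (t : ℝ) : aoiMD a₀ T s t = t - freshest a₀ T s t := rfl

section Path

variable {a₀ T : ℝ} {s : ℕ → ℝ}

lemma le_of_mem_receivedGenTimes (ha₀ : 0 ≤ a₀) (hT : 0 ≤ T) (hs : ∀ i, 0 ≤ s i) {t : ℝ}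
    (ht : 0 ≤ t) {g : ℝ} (hg : g ∈ receivedGenTimes a₀ s (fun _ => T) t) : g ≤ t := by
  rcases hg with (rfl | ⟨i, hi, rfl⟩) | ⟨i, hi, rfl⟩
  · linarith
  · rw [recvTime] at hi
    linarith [hs i]
  · rw [recvTime] at hi
    linarith

lemma neg_mem_receivedGenTimes (t : ℝ) : -a₀ ∈ receivedGenTimes a₀ s (fun _ => T) t :=
  Or.inl (Or.inl rfl)

lemma bddAbove_receivedGenTimes (ha₀ : 0 ≤ a₀) (hT : 0 ≤ T) (hs : ∀ i, 0 ≤ s i) {t : ℝ}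
    (ht : 0 ≤ t) : BddAbove (receivedGenTimes a₀ s (fun _ => T) t) :=
  ⟨t, fun _ hg => le_of_mem_receivedGenTimes ha₀ hT hs ht hg⟩

lemma freshest_le_iff (ha₀ : 0 ≤ a₀) (hT : 0 ≤ T) (hs : ∀ i, 0 ≤ s i) {t : ℝ} (ht : 0 ≤ t)
    {r : ℝ} : freshest a₀ T s t ≤ r ↔ ∀ g ∈ receivedGenTimes a₀ s (fun _ => T) t, g ≤ r :=
  csSup_le_iff (bddAbove_receivedGenTimes ha₀ hT hs ht) ⟨_, neg_mem_receivedGenTimes t⟩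

lemma freshest_le_self (ha₀ : 0 ≤ a₀) (hT : 0 ≤ T) (hs : ∀ i, 0 ≤ s i) {t : ℝ} (ht : 0 ≤ t) :
    freshest a₀ T s t ≤ t :=
  (freshest_le_iff ha₀ hT hs ht).2 fun _ hg => le_of_mem_receivedGenTimes ha₀ hT hs ht hg

lemma monotoneOn_freshest (ha₀ : 0 ≤ a₀) (hT : 0 ≤ T) (hs : ∀ i, 0 ≤ s i) :
    MonotoneOn (freshest a₀ T s) (Set.Ici 0) := by
  intro t _ u hu htu
  refine csSup_le_csSup (bddAbove_receivedGenTimes ha₀ hT hs hu)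
    ⟨_, neg_mem_receivedGenTimes t⟩ ?_
  rintro g ((h | ⟨i, hi, rfl⟩) | ⟨i, hi, rfl⟩)
  · exact Or.inl (Or.inl h)
  · exact Or.inl (Or.inr ⟨i, hi.trans htu, rfl⟩)
  · exact Or.inr ⟨i, hi.trans htu, rfl⟩

lemma aoiMD_nonneg (ha₀ : 0 ≤ a₀) (hT : 0 ≤ T) (hs : ∀ i, 0 ≤ s i) {t : ℝ} (ht : 0 ≤ t) :
    0 ≤ aoiMD a₀ T s t :=
  sub_nonneg.2 (freshest_le_self ha₀ hT hs ht)

lemma intervalIntegrable_aoiMD (ha₀ : 0 ≤ a₀) (hT : 0 ≤ T) (hs : ∀ i, 0 ≤ s i) {a b : ℝ}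
    (ha : 0 ≤ a) (hb : 0 ≤ b) : IntervalIntegrable (aoiMD a₀ T s) volume a b := by
  -- The age is the identity minus a function monotone on `[0, ∞)`.
  refine IntervalIntegrable.sub (f := fun t => t) (g := freshest a₀ T s)
    (continuous_id.intervalIntegrable a b) ?_
  refine MonotoneOn.intervalIntegrable ((monotoneOn_freshest ha₀ hT hs).mono fun x hx => ?_)
  exact (le_min ha hb).trans hx.1

lemma le_freshest (ha₀ : 0 ≤ a₀) (hT : 0 ≤ T) (hs : ∀ i, 0 ≤ s i) {j : ℕ} {t : ℝ}
    (ht : (j + 1) * T ≤ t) : j * T ≤ freshest a₀ T s t := by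
  have h0 : 0 ≤ t := le_trans (by positivity) ht
  refine le_csSup (bddAbove_receivedGenTimes ha₀ hT hs h0) (Or.inr ⟨j, ?_, ?_⟩)
  · rwa [recvTime_const]
  · rw [genTime_const]

/-- Update `i + 1` of A is generated at the reception of update `i`, so it is fresher than `r` and
available at `t` iff both receptions fall in `(r, t]`. Nothing else beats `r`: the initial
information and A's first update date from time `0` or earlier, and B's updates received before
`(j+2)T` from `jT` or earlier. At `t = (j+2)T` B delivers again, hence the strict bound. -/
lemma freshest_le_iff_mem_fewReceived (ha₀ : 0 ≤ a₀) (hT : 0 < T) (hs : ∀ i, 0 ≤ s i) {j : ℕ}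
    {t r : ℝ} (ht : (j + 1) * T ≤ t) (ht' : t < (j + 2) * T) (hr : j * T < r) :
    freshest a₀ T s t ≤ r ↔ s ∈ fewReceived r t := by
  have h0 : 0 ≤ t := le_trans (by positivity) ht
  have hr0 : 0 ≤ r := le_trans (by positivity) hr.le
  rw [freshest_le_iff ha₀ hT.le hs h0]
  constructor
  · intro h i
    by_contra! hi
    refine absurd (h (genTime s (i + 1)) (Or.inl (Or.inr ⟨i + 1, hi.2, rfl⟩))) ?_
    rw [genTime_succ]
    exact not_le.2 hi.1
  · rintro h g ((rfl | ⟨i, hi, rfl⟩) | ⟨i, hi, rfl⟩)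
    · linarith
    · cases i with
      | zero => rwa [genTime_zero]
      | succ i =>
        rw [genTime_succ]
        exact (h i).resolve_right (not_lt.2 hi)
    · rw [recvTime_const] at hi
      rw [genTime_const]
      have h1 : ((i : ℝ) + 1) * T < (j + 2) * T := hi.trans_lt ht'
      have h2 : (i : ℝ) + 1 < j + 2 := lt_of_mul_lt_mul_right h1 hT.le
      have h3 : i ≤ j := by
        have : i + 1 < j + 2 := by exact_mod_cast h2
        omega
      have h4 : (i : ℝ) * T ≤ j * T := by gcongr
      linarith

/-- With `F` the freshest generation time, the slice lies between `(F, t]` and `[F, t]`. The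
constraint `jT < r` costs nothing on `(F, t]`, since B ensures `jT ≤ F`. -/
lemma volume_ageRegion_slice (ha₀ : 0 ≤ a₀) (hT : 0 < T) (hs : ∀ i, 0 ≤ s i) {j : ℕ} {t : ℝ}
    (ht : (j + 1) * T < t) (ht' : t < (j + 2) * T) :
    volume (Prod.mk t ⁻¹' ageRegion T (j * T) s) = ENNReal.ofReal (aoiMD a₀ T s t) := by
  have h0 : 0 ≤ t := le_trans (by positivity) ht.le
  have h1 : (j : ℝ) * T + T < t ∧ t ≤ j * T + 2 * T := ⟨by linarith, by linarith⟩
  have hmem : ∀ r, r ∈ Prod.mk t ⁻¹' ageRegion T (j * T) s ↔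
      (j * T < r ∧ r ≤ t) ∧ freshest a₀ T s t ≤ r := by
    intro r
    simp only [ageRegion, Set.mem_preimage, Set.mem_ofPred_eq, h1, true_and, and_self]
    exact and_congr_right fun hr =>
      (freshest_le_iff_mem_fewReceived ha₀ hT hs ht.le ht' hr.1).symm
  have hle := le_freshest ha₀ hT.le hs ht.le
  rw [aoiMD_eq]
  refine le_antisymm ?_ ?_
  · rw [← Real.volume_Icc]
    exact measure_mono fun r hr => ⟨((hmem r).1 hr).2, ((hmem r).1 hr).1.2⟩
  · rw [← Real.volume_Ioc]
    exact measure_mono fun r hr => (hmem r).2 ⟨⟨hle.trans_lt hr.1, hr.2⟩, hr.1.le⟩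

lemma periodArea_succ (ha₀ : 0 ≤ a₀) (hT : 0 < T) (hs : ∀ i, 0 ≤ s i) (j : ℕ) :
    periodArea a₀ T s (j + 1) = ageArea T (j * T) s := by
  have hR := measurableSet_ageRegion T (j * T) s
  have hle : ((j + 1 : ℕ) : ℝ) * T ≤ ((j + 1 : ℕ) + 1) * T := by nlinarith
  rw [periodArea, intervalIntegral.integral_of_le hle, integral_Ioc_eq_integral_Ioo]
  have h1 : ∫ t in Set.Ioo (((j + 1 : ℕ) : ℝ) * T) (((j + 1 : ℕ) + 1) * T), aoiMD a₀ T s t =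
      ∫ t in Set.Ioo (((j + 1 : ℕ) : ℝ) * T) (((j + 1 : ℕ) + 1) * T),
        (volume (Prod.mk t ⁻¹' ageRegion T (j * T) s)).toReal := by
    refine setIntegral_congr_fun measurableSet_Ioo fun t ht => ?_
    obtain ⟨ht1, ht2⟩ := ht
    push_cast at ht1 ht2
    have h0 : 0 ≤ t := le_trans (by positivity) ht1.le
    rw [volume_ageRegion_slice ha₀ hT hs ht1 (by linarith),
      ENNReal.toReal_ofReal (aoiMD_nonneg ha₀ hT.le hs h0)]
  rw [h1, integral_toReal
    (measurable_measure_prodMk_left hR).aemeasurable, ageArea, Measure.volume_eq_prod,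
    Measure.prod_apply hR, setLIntegral_congr Ioo_ae_eq_Ioc,
    ← lintegral_indicator measurableSet_Ioc]
  · congr 1
    refine lintegral_congr fun t => ?_
    by_cases ht : t ∈ Set.Ioc (((j + 1 : ℕ) : ℝ) * T) (((j + 1 : ℕ) + 1) * T)
    · rw [Set.indicator_of_mem ht]
    · rw [Set.indicator_of_notMem ht]
      refine (Eq.trans (congrArg volume ?_) (measure_empty (μ := (volume : Measure ℝ)))).symm
      ext r
      simp only [ageRegion, Set.mem_preimage, Set.mem_ofPred_eq, Set.mem_empty_iff_false,
        iff_false]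
      intro h
      refine ht ⟨?_, ?_⟩ <;> push_cast <;> linarith [h.1.1, h.1.2]
  · filter_upwards [ae_restrict_mem measurableSet_Ioo] with t ht
    obtain ⟨ht1, ht2⟩ := ht
    push_cast at ht1 ht2
    rw [volume_ageRegion_slice ha₀ hT hs ht1 (by linarith)]
    exact ENNReal.ofReal_lt_top

/-- The period `[0, T]` stands apart because B has delivered nothing before its end, so the initial
age can matter there. The next `2n` periods are grouped by parity, as neighbouring periods share
receptions. -/
lemma integral_aoiMD_odd_mul (ha₀ : 0 ≤ a₀) (hT : 0 < T) (hs : ∀ i, 0 ≤ s i) (n : ℕ) :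
    ∫ t in (0 : ℝ)..(2 * T * n + T), aoiMD a₀ T s t = (∫ t in (0 : ℝ)..T, aoiMD a₀ T s t) +
      (∑ i ∈ Finset.range n, ageArea T ((2 * i : ℕ) * T) s +
        ∑ i ∈ Finset.range n, ageArea T ((2 * i + 1 : ℕ) * T) s) := by
  induction n with
  | zero => simp
  | succ n ih =>
    have h1 := periodArea_succ ha₀ hT hs (2 * n)
    have h2 := periodArea_succ ha₀ hT hs (2 * n + 1)
    rw [periodArea] at h1 h2
    rw [Finset.sum_range_succ, Finset.sum_range_succ, ← h1, ← h2]
    have e1 : ((2 * n + 1 : ℕ) : ℝ) * T = 2 * T * n + T := by push_cast; ring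
    have e2 : (((2 * n + 1 : ℕ) : ℝ) + 1) * T = 2 * T * n + 2 * T := by push_cast; ring
    have e3 : ((2 * n + 1 + 1 : ℕ) : ℝ) * T = 2 * T * n + 2 * T := by push_cast; ring
    have e4 : (((2 * n + 1 + 1 : ℕ) : ℝ) + 1) * T = 2 * T * (n + 1 : ℕ) + T := by push_cast; ring
    rw [e1, e2, e3, e4]
    have hi : ∀ a b : ℝ, 0 ≤ a → 0 ≤ b → IntervalIntegrable (aoiMD a₀ T s) volume a b :=
      fun a b ha hb => intervalIntegrable_aoiMD ha₀ hT.le hs ha hb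
    have p1 : 0 ≤ 2 * T * n + T := by positivity
    have p2 : 0 ≤ 2 * T * n + 2 * T := by positivity
    have p3 : 0 ≤ 2 * T * (n + 1 : ℕ) + T := by positivity
    rw [← intervalIntegral.integral_add_adjacent_intervals (hi 0 _ le_rfl p2) (hi _ _ p2 p3),
      ← intervalIntegral.integral_add_adjacent_intervals (hi 0 _ le_rfl p1) (hi _ _ p1 p2), ih]
    ring

end Path

/-! ### The time average -/

lemma tendsto_natFloor_sub_div_div {a b : ℝ} (ha : 0 < a) :
    Tendsto (fun τ : ℝ => (⌊(τ - b) / a⌋₊ : ℝ) / τ) atTop (𝓝 (1 / a)) := by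
  have h1 : Tendsto (fun τ : ℝ => (τ - b) / a) atTop atTop :=
    (tendsto_atTop_add_const_right _ (-b) tendsto_id).atTop_div_const ha
  have h2 : Tendsto (fun τ : ℝ => (τ - b) / a / τ) atTop (𝓝 (1 / a)) := by
    have h3 : Tendsto (fun τ : ℝ => 1 / a - b / a * τ⁻¹) atTop (𝓝 (1 / a - b / a * 0)) :=
      (tendsto_inv_atTop_zero.const_mul _).const_sub _
    rw [mul_zero, sub_zero] at h3
    refine h3.congr' ?_
    filter_upwards [eventually_gt_atTop 0] with τ hτ
    field_simp
  have h4 := ((tendsto_nat_floor_div_atTop (R := ℝ)).comp h1).mul h2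
  rw [one_mul] at h4
  refine h4.congr' ?_
  filter_upwards [h1.eventually_gt_atTop 0] with τ hτ
  simp only [Function.comp]
  rw [div_mul_div_comm, mul_comm ((τ - b) / a), mul_div_mul_right _ _ hτ.ne']

/-- With `n = ⌊(τ - b) / a⌋₊`, monotonicity squeezes `I τ` between the values at `a n + b` and `a (n
+ 1) + b`, while `n / τ` and `(n + 1) / τ` both tend to `1 / a`. -/
lemma tendsto_div_of_monotoneOn {I : ℝ → ℝ} (hmono : MonotoneOn I (Set.Ici 0)) {a b L : ℝ}
    (ha : 0 < a) (hb : 0 ≤ b)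
    (hlim : Tendsto (fun n : ℕ => I (a * n + b) / n) atTop (𝓝 L)) :
    Tendsto (fun τ : ℝ => 1 / τ * I τ) atTop (𝓝 (L / a)) := by
  have hx : Tendsto (fun τ : ℝ => (τ - b) / a) atTop atTop :=
    (tendsto_atTop_add_const_right _ (-b) tendsto_id).atTop_div_const ha
  have hN : Tendsto (fun τ : ℝ => ⌊(τ - b) / a⌋₊) atTop atTop := tendsto_nat_floor_atTop.comp hx
  have hfl := tendsto_natFloor_sub_div_div (b := b) ha
  have hlow := (hlim.comp hN).mul hfl
  have hfl' : Tendsto (fun τ : ℝ => ((⌊(τ - b) / a⌋₊ + 1 : ℕ) : ℝ) / τ) atTop (𝓝 (1 / a)) := by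
    have := hfl.add tendsto_inv_atTop_zero
    rw [add_zero] at this
    refine this.congr fun τ => ?_
    push_cast
    rw [add_div, one_div]
  have hup := (hlim.comp ((tendsto_add_atTop_nat 1).comp hN)).mul hfl'
  rw [mul_one_div] at hlow hup
  refine tendsto_of_tendsto_of_tendsto_of_le_of_le' hlow hup ?_ ?_
  · filter_upwards [eventually_gt_atTop 0, hN.eventually_gt_atTop 0, hx.eventually_ge_atTop 0]
      with τ hτ hn hxτ
    have hn' : (0 : ℝ) < ⌊(τ - b) / a⌋₊ := by exact_mod_cast hn
    have hle : a * ⌊(τ - b) / a⌋₊ + b ≤ τ := by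
      have := Nat.floor_le hxτ
      rw [le_div_iff₀ ha] at this
      linarith
    have := hmono (Set.mem_Ici.2 (by positivity)) (Set.mem_Ici.2 hτ.le) hle
    simp only [Function.comp]
    rw [div_mul_div_cancel₀ hn'.ne', one_div, inv_mul_eq_div]
    gcongr
  · filter_upwards [eventually_gt_atTop 0] with τ hτ
    have hn' : (0 : ℝ) < (⌊(τ - b) / a⌋₊ + 1 : ℕ) := by positivity
    have hle : τ ≤ a * (⌊(τ - b) / a⌋₊ + 1 : ℕ) + b := by
      have := (Nat.lt_floor_add_one ((τ - b) / a)).le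
      rw [div_le_iff₀ ha] at this
      push_cast
      linarith
    have := hmono (Set.mem_Ici.2 hτ.le) (Set.mem_Ici.2 (by positivity)) hle
    simp only [Function.comp]
    rw [div_mul_div_cancel₀ hn'.ne', one_div, inv_mul_eq_div]
    gcongr

lemma monotoneOn_integral_aoiMD {a₀ T : ℝ} {s : ℕ → ℝ} (ha₀ : 0 ≤ a₀) (hT : 0 ≤ T)
    (hs : ∀ i, 0 ≤ s i) :
    MonotoneOn (fun τ => ∫ t in (0 : ℝ)..τ, aoiMD a₀ T s t) (Set.Ici 0) := by
  intro x hx y hy hxy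
  have hi : ∀ a b : ℝ, 0 ≤ a → 0 ≤ b → IntervalIntegrable (aoiMD a₀ T s) volume a b :=
    fun a b ha hb => intervalIntegrable_aoiMD ha₀ hT hs ha hb
  simp only
  rw [← intervalIntegral.integral_add_adjacent_intervals (hi 0 x le_rfl hx) (hi x y hx hy)]
  exact le_add_of_nonneg_right (intervalIntegral.integral_nonneg hxy fun t ht =>
    aoiMD_nonneg ha₀ hT hs (le_trans hx ht.1))

lemma ae_tendsto_sum_ageArea {μ T : ℝ} (hμ : 0 < μ) (hT : 0 ≤ T) (f : ℕ → ℕ)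
    (hf : ∀ i j, i < j → f i + 2 ≤ f j) :
    ∀ᵐ s ∂(expSeq μ), Tendsto (fun n : ℕ => (∑ i ∈ Finset.range n, ageArea T (f i * T) s) / n)
      atTop (𝓝 (∫ s, ageArea T 0 s ∂(expSeq μ))) := by
  have hident : ∀ i, IdentDistrib (ageArea T (f i * T)) (ageArea T 0) (expSeq μ) (expSeq μ) :=
    fun i => identDistrib_ageArea hμ T (by positivity)
  have hind : ∀ i j, i < j →
      IndepFun (ageArea T (f i * T)) (ageArea T (f j * T)) (expSeq μ) := by
    intro i j hij
    refine indepFun_ageArea hμ hT (by positivity) ?_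
    have : (f i : ℝ) + 2 ≤ f j := by exact_mod_cast hf i j hij
    nlinarith
  -- This strong law asks only for pairwise independence, so the statement about two periods
  -- suffices.
  have h := strong_law_ae_real (μ := expSeq μ) (fun i => ageArea T (f i * T))
    (integrable_ageArea hμ T _) ?_ (fun i => (hident i).trans (hident 0).symm)
  · rwa [(hident 0).integral_eq] at h
  · intro i j hij
    rcases lt_or_gt_of_ne hij with h | h
    · exact hind i j h
    · exact (hind j i h).symm

lemma ae_tendsto_average_aoiMD {μ T a₀ : ℝ} (hμ : 0 < μ) (hT : 0 < T) (ha₀ : 0 ≤ a₀) :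
    ∀ᵐ s ∂(expSeq μ), Tendsto (fun τ : ℝ => 1 / τ * ∫ t in (0 : ℝ)..τ, aoiMD a₀ T s t) atTop
      (𝓝 ((∫ s, ageArea T 0 s ∂(expSeq μ)) / T)) := by
  filter_upwards [ae_expSeq_pos hμ,
    ae_tendsto_sum_ageArea hμ hT.le (fun i => 2 * i) (fun i j h => by omega),
    ae_tendsto_sum_ageArea hμ hT.le (fun i => 2 * i + 1) (fun i j h => by omega)]
    with s hs h0 h1
  have hs' : ∀ i, 0 ≤ s i := fun i => (hs i).le
  have hconst : Tendsto (fun n : ℕ => (∫ t in (0 : ℝ)..T, aoiMD a₀ T s t) / n) atTop (𝓝 0) :=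
    tendsto_const_div_atTop_nhds_zero_nat _
  have h := hconst.add (h0.add h1)
  rw [zero_add, ← two_mul] at h
  have h' : Tendsto (fun n : ℕ => (∫ t in (0 : ℝ)..(2 * T * n + T), aoiMD a₀ T s t) / n) atTop
      (𝓝 (2 * ∫ s, ageArea T 0 s ∂(expSeq μ))) := by
    refine h.congr fun n => ?_
    rw [integral_aoiMD_odd_mul ha₀ hT hs' n]
    ring
  have := tendsto_div_of_monotoneOn (monotoneOn_integral_aoiMD ha₀ hT.le hs')
    (by positivity : 0 < 2 * T) hT.le h'
  rwa [mul_div_mul_left _ _ two_ne_zero] at this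

/-! ### Total expectation over the states, and the conclusion -/

/-- The weight `P.real (E i)` cancels the normalisation of the conditional measure, leaving
integrals over the cells of a partition. -/
lemma hasSum_cond_average {Ω ι : Type*} [MeasurableSpace Ω] [Countable ι] {P : Measure Ω}
    [IsFiniteMeasure P] {E : ι → Set Ω} (hE : ∀ i, MeasurableSet (E i))
    (hd : Pairwise (Function.onFun Disjoint E)) (hcover : ∀ᵐ ω ∂P, ω ∈ ⋃ i, E i)
    (hpos : ∀ i, P.real (E i) ≠ 0) {f : Ω → ℝ} (hf : Integrable f P) (c : ℝ) :
    HasSum (fun i => P.real (E i) * ((∫ ω, f ω ∂(P[|E i])) / c)) ((∫ ω, f ω ∂P) / c) := by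
  have h := (hasSum_integral_iUnion hE hd hf.integrableOn).div_const c
  rw [Measure.restrict_eq_self_of_ae_mem hcover] at h
  have heq : ∀ i, P.real (E i) * ((∫ ω, f ω ∂(P[|E i])) / c) = (∫ ω in E i, f ω ∂P) / c := by
    intro i
    rw [ProbabilityTheory.cond, integral_smul_measure, ENNReal.toReal_inv, smul_eq_mul,
      ← measureReal_def, mul_div_assoc, mul_inv_cancel_left₀ (hpos i)]
  simpa only [heq] using h

theorem proposition4 {Ω : Type*} [MeasurableSpace Ω] (P : Measure Ω) [IsProbabilityMeasure P]
    (μ T a₀ : ℝ) (hμ : 0 < μ) (hT : 0 < T) (ha₀ : 0 ≤ a₀)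
    (S : ℕ → Ω → ℝ) (hmeas : ∀ i, Measurable (S i))
    (hlaw : ∀ i, P.map (S i) = expMeasure μ) (hindep : iIndepFun S P) :
    -- almost surely, the time average of the age of information converges to the stated value
    (∀ᵐ ω ∂P,
      (∀ τ : ℝ, 0 ≤ τ →
        IntervalIntegrable (aoiMD a₀ T (fun i => S i ω)) volume 0 τ) ∧
      Tendsto (fun τ : ℝ => (1 / τ) * ∫ t in (0 : ℝ)..τ, aoiMD a₀ T (fun i => S i ω) t) atTop
        (𝓝 ((3 + 2 * T * μ + Real.exp (T * μ) * (-3 + (-1 + 2 * Real.exp (T * μ)) * (T * μ)))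
          / (T * μ ^ 2 * Real.exp (2 * (T * μ)))))) ∧
    -- and this value is the Poisson-weighted mean of the average ages in the states `(k, n)`
    (∀ j : ℕ,
      Integrable (fun ω => periodArea a₀ T (fun i => S i ω) (j + 1)) P ∧
      (∀ k n : ℕ,
        P.real (stateEvent T S j k n) = poissonProb (μ * T) k * poissonProb (μ * T) n) ∧
      HasSum
        (fun x : ℕ × ℕ => poissonProb (μ * T) x.1 * poissonProb (μ * T) x.2 *
          ((∫ ω, periodArea a₀ T (fun i => S i ω) (j + 1) ∂(P[|stateEvent T S j x.1 x.2])) / T))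
        ((3 + 2 * T * μ + Real.exp (T * μ) * (-3 + (-1 + 2 * Real.exp (T * μ)) * (T * μ)))
          / (T * μ ^ 2 * Real.exp (2 * (T * μ))))) := by
  have hSm : Measurable fun ω i => S i ω := measurable_pi_iff.2 hmeas
  -- Independence makes the joint law the product law, so everything is transferred from sequence
  -- space.
  have hmap : P.map (fun ω i => S i ω) = expSeq μ := by
    rw [hindep.map_fun_eq_infinitePi_map hmeas, expSeq]
    simp_rw [hlaw]
  have hae : ∀ p : (ℕ → ℝ) → Prop, (∀ᵐ s ∂(expSeq μ), p s) → ∀ᵐ ω ∂P, p fun i => S i ω := by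
    intro p hp
    rw [← hmap] at hp
    exact ae_of_ae_map hSm.aemeasurable hp
  have hmean : (∫ s, ageArea T 0 s ∂(expSeq μ)) / T =
      (3 + 2 * T * μ + Real.exp (T * μ) * (-3 + (-1 + 2 * Real.exp (T * μ)) * (T * μ)))
          / (T * μ ^ 2 * Real.exp (2 * (T * μ))) := by
    rw [integral_ageArea_zero hμ hT, mul_div_cancel_left₀ _ hT.ne']
  rw [← hmean]
  refine ⟨?_, fun j => ?_⟩
  · filter_upwards [hae _ (ae_expSeq_pos hμ), hae _ (ae_tendsto_average_aoiMD hμ hT ha₀)]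
      with ω hpos hlim
    exact ⟨fun τ hτ => intervalIntegrable_aoiMD ha₀ hT.le (fun i => (hpos i).le) le_rfl hτ, hlim⟩
  have hQ : (fun ω => periodArea a₀ T (fun i => S i ω) (j + 1)) =ᵐ[P]
      fun ω => ageArea T (j * T) fun i => S i ω := by
    filter_upwards [hae _ (ae_expSeq_pos hμ)] with ω hpos
    exact periodArea_succ ha₀ hT (fun i => (hpos i).le) j
  have hint : Integrable (fun ω => periodArea a₀ T (fun i => S i ω) (j + 1)) P := by
    refine Integrable.congr ?_ hQ.symm
    have h := integrable_ageArea hμ T (j * T)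
    rw [← hmap] at h
    exact h.comp_measurable hSm
  have hQmean : ∫ ω, periodArea a₀ T (fun i => S i ω) (j + 1) ∂P =
      ∫ s, ageArea T 0 s ∂(expSeq μ) := by
    rw [integral_congr_ae hQ, ← (identDistrib_ageArea hμ T
      (by positivity : 0 ≤ (j : ℝ) * T)).integral_eq, ← hmap,
      integral_map hSm.aemeasurable (measurable_ageArea T _).aestronglyMeasurable]
  have hevent : ∀ k n : ℕ, stateEvent T S j k n = (fun ω i => S i ω) ⁻¹'
      ({s | numReceived s (j * T) ((j + 1) * T) = k} ∩
        {s | numReceived s ((j + 1) * T) ((j + 2) * T) = n}) := fun _ _ => rfl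
  have hEm : ∀ k n : ℕ, MeasurableSet (stateEvent T S j k n) := fun k n =>
    hSm ((measurableSet_numReceived _ _ k).inter (measurableSet_numReceived _ _ n))
  have hprob : ∀ k n : ℕ,
      P.real (stateEvent T S j k n) = poissonProb (μ * T) k * poissonProb (μ * T) n := by
    intro k n
    have e1 : ((j : ℝ) + 1) * T - j * T = T := by ring
    have e2 : ((j : ℝ) + 2) * T - (j + 1) * T = T := by ring
    rw [measureReal_def, hevent, ← Measure.map_apply hSm
      ((measurableSet_numReceived _ _ k).inter (measurableSet_numReceived _ _ n)), hmap,
      expSeq_numReceived_inter hμ (by positivity) (by nlinarith) (by nlinarith), e1, e2,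
      ENNReal.toReal_mul, ENNReal.toReal_ofReal (poissonProb_nonneg (by positivity) _),
      ENNReal.toReal_ofReal (poissonProb_nonneg (by positivity) _)]
  refine ⟨hint, hprob, ?_⟩
  -- Counts live in `ℕ∞`; the states exhaust the space up to a null set because both counts are
  -- almost surely finite.
  have hcover : ∀ᵐ ω ∂P, ω ∈ ⋃ x : ℕ × ℕ, stateEvent T S j x.1 x.2 := by
    filter_upwards [hae _ (ae_expSeq_pos hμ),
      hae _ (ae_exists_mem_stage hμ (by positivity : 0 ≤ ((j : ℝ) + 1) * T)),
      hae _ (ae_exists_mem_stage hμ (by positivity : 0 ≤ ((j : ℝ) + 2) * T))] with ω hpos h1 h2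
    obtain ⟨m, hm⟩ := Set.mem_iUnion.1 h1
    obtain ⟨m', hm'⟩ := Set.mem_iUnion.1 h2
    obtain ⟨k, hk⟩ := ENat.ne_top_iff_exists.1
      (numReceived_ne_top (a := j * T) (fun i => (hpos i).le) hm)
    obtain ⟨n, hn⟩ := ENat.ne_top_iff_exists.1
      (numReceived_ne_top (a := (j + 1) * T) (fun i => (hpos i).le) hm')
    exact Set.mem_iUnion.2 ⟨(k, n), hk.symm, hn.symm⟩
  have hdisj : Pairwise (Function.onFun Disjoint fun x : ℕ × ℕ => stateEvent T S j x.1 x.2) := by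
    rintro ⟨k, n⟩ ⟨k', n'⟩ hne
    refine Set.disjoint_left.2 fun ω h h' => hne ?_
    have hk : (k : ℕ∞) = k' := h.1.symm.trans h'.1
    have hn : (n : ℕ∞) = n' := h.2.symm.trans h'.2
    exact Prod.ext (by exact_mod_cast hk) (by exact_mod_cast hn)
  have hr : 0 < μ * T := mul_pos hμ hT
  have h := hasSum_cond_average (fun x : ℕ × ℕ => hEm x.1 x.2) hdisj hcover
    (fun x => by
      rw [hprob]
      exact (mul_pos (poissonProb_pos hr _) (poissonProb_pos hr _)).ne') hint T
  simp_rw [hprob] at h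
  rwa [hQmean] at h
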